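/- Let $H$ be a complex Hilbert space and $B(H)$ the algebra of bounded linear operators on $H$. For $T\in B(H)$ write $|T|=(T^*T)^{1/2}$; for $p>0$, $T$ is called $p$-hyponormal if $(T^*T)^p\ge (TT^*)^p$. An $n$-tuple $(T_1,\dots,T_n)\in B(H)^n$ is doubly commuting if $T_iT_j=T_jT_i$ and $T_iT_j^*=T_j^*T_i$ for all $i\ne j$. For a commuting $n$-tuple $\mathbf T=(T_1,\dots,T_n)$ let $\Lambda^k(\mathbb C^n)$ be the $k$-th exterior power, with basis $e_{j_1}\wedge\dots\wedge e_{j_k}$ ($j_1<\dots<j_k$), and let $D_k:H\otimes\Lambda^k(\mathbb C^n)\to H\otimes\Lambda^{k-1}(\mathbb C^n)$, $$D_k(x\otimes e_{j_1}\wedge\dots\wedge e_{j_k})=\sum_{i=1}^k(-1)^{i-1}\,T_{j_i}x\otimes e_{j_1}\wedge\dots\wedge\check e_{j_i}\wedge\dots\wedge e_{j_k},$$ where $\check e_{j_i}$ means that this factor is deleted. The Taylor spectrum $\sigma_T(\mathbf T)$ is the set of all $z=(z_1,\dots,z_n)\in\mathbb C^n$ for which the Koszul complex $$0\to H\otimes\Lambda^n(\mathbb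 C^n)\xrightarrow{D_n}\cdots\xrightarrow{D_2}H\otimes\Lambda^1(\mathbb C^n)\xrightarrow{D_1}H\otimes\Lambda^0(\mathbb C^n)\to 0$$ of $(T_1-z_1,\dots,T_n-z_n)$ is not exact. Let $0<p<1$ and let $\mathbf T=(T_1,\dots,T_n)$ be a doubly commuting $n$-tuple of $p$-hyponormal operators on $H$. Let $U_1,\dots,U_n\in B(H)$ be unitary operators with $T_j=U_j|T_j|$ for $j=1,\dots,n$, and put $\mathbf S=(U_1|T_1|^{2p},\dots,U_n|T_n|^{2p})$. Then $\mathbf S$ is a commuting $n$-tuple, and $$\sigma_T(\mathbf S)=\left\{(r_1^{2p}e^{i\theta_1},\dots,r_n^{2p}e^{i\theta_n}) : r_j\ge 0,\ \theta_j\in\mathbb R,\ (r_1e^{i\theta_1},\dots,r_ne^{i\theta_n})\in\sigma_T(\mathbf T)\right\}.$$ -/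

import Mathlib

namespace TaylorSpectrum

variable {H : Type*} [NormedAddCommGroup H] [InnerProductSpace ℂ H]

/-- `E n k H` is `H ⊗ Λᵏ(ℂⁿ)`, written as the direct sum of `n.choose k` copies of `H`: the
coordinate of a vector at the set `s = {j₁ < ⋯ < jₖ}` is its coefficient at
`e_{j₁} ∧ ⋯ ∧ e_{jₖ}`. -/
abbrev E (n k : ℕ) (H : Type*) : Type _ := {s : Finset (Fin n) // s.card = k} → H

/-- The set `s ∪ {i}` with `i ∉ s`, as an index of the next higher degree. -/
def insertIdx {n k : ℕ} (s : {s : Finset (Fin n) // s.card = k}) (i : {i : Fin n // i ∉ s.1}) :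
    {s : Finset (Fin n) // s.card = k + 1} :=
  ⟨insert i.1 s.1, by rw [Finset.card_insert_of_notMem i.2, s.2]⟩

/-- The Koszul boundary map `E (k+1) → E k` of a tuple of operators,
`x ⊗ e_{j₁} ∧ ⋯ ∧ e_{j_{k+1}} ↦ ∑ₗ (-1)^(l-1) T_{jₗ} x ⊗ e_{j₁} ∧ ⋯ (omit e_{jₗ}) ⋯ ∧ e_{j_{k+1}}`.
Read at the coordinate `s`, the contributions come from the sets `s ∪ {i}`, `i ∉ s`, and
`l - 1` is the number of elements of `s` that are smaller than `i`. -/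
def koszulD {n : ℕ} (T : Fin n → H →L[ℂ] H) (k : ℕ) : E n (k + 1) H →ₗ[ℂ] E n k H :=
  LinearMap.pi fun s =>
    ∑ i : {i : Fin n // i ∉ s.1},
      (-1 : ℂ) ^ (s.1.filter (fun j => j < i.1)).card •
        ((T i.1 : H →ₗ[ℂ] H) ∘ₗ LinearMap.proj (insertIdx s i))

/-- The Koszul complex `0 → E n n → ⋯ → E n 1 → E n 0 → 0` is exact. Exactness at `E n 0` is
surjectivity of the last map. The spaces `E n k` with `k > n` are zero, so that exactness at
`E n n` says that the first map is injective. -/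
def KoszulExact {n : ℕ} (T : Fin n → H →L[ℂ] H) : Prop :=
  Function.Surjective (koszulD T 0) ∧
    ∀ k : ℕ, Function.Exact (koszulD T (k + 1)) (koszulD T k)

/-- The Taylor spectrum of a (commuting) tuple: the points `z` for which the Koszul complex of
`(T₁ - z₁, …, Tₙ - zₙ)` is not exact. -/
def taylorSpectrum {n : ℕ} (T : Fin n → H →L[ℂ] H) : Set (Fin n → ℂ) :=
  {z | ¬ KoszulExact (fun j => T j - z j • (1 : H →L[ℂ] H))}

variable [CompleteSpace H]

/-- `T` is `p`-hyponormal: `(T T*)^p ≤ (T* T)^p` in the order given by positive operators. -/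
def IsPHyponormal (p : ℝ) (T : H →L[ℂ] H) : Prop :=
  (T * star T) ^ p ≤ (star T * T) ^ p

/-- The tuple is doubly commuting: `Tᵢ Tⱼ = Tⱼ Tᵢ` and `Tᵢ Tⱼ* = Tⱼ* Tᵢ` for `i ≠ j`. -/
def DoublyCommuting {n : ℕ} (T : Fin n → H →L[ℂ] H) : Prop :=
  ∀ i j, i ≠ j → Commute (T i) (T j) ∧ Commute (T i) (star (T j))

end TaylorSpectrum

/-!
For a doubly commuting tuple the Laplacian `D D* + D* D` of the Koszul complex is diagonal, with
entries `∑_{i ∈ s} Rᵢ* Rᵢ + ∑_{i ∉ s} Rᵢ Rᵢ*`, where `Rᵢ = Tᵢ - zᵢ`; so the complex is exact once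
all these sums are invertible, whereas exactness at the end alone makes `∑ Rᵢ Rᵢ*` invertible.
If the approximate null vectors of `Rᵢ` are also approximate null vectors of `Rᵢ*`, then
invertibility of `∑ Rᵢ Rᵢ*` implies that of all the other sums, and `z` lies in the Taylor
spectrum if and only if the `Rᵢ*` have a common sequence of approximate null vectors
(`koszulExact_iff`).

That property of `Rᵢ` holds for all operators `S_q = U |T|^q` with `q ≥ p`, if `T = U |T|` is
`p`-hyponormal: in terms of the spectral measures of `|T|` at approximate eigenvectors, the
inequality `U |T|²ᵖ U* ≤ |T|²ᵖ` is opposite to the association inequality of Chebyshev, so that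
the measures concentrate at one point (`approxEigen_modulus_of_pos`, `approxEigen_star`). Hence
approximate eigenvectors of one `S_q` for `r^q e^{iθ}` are approximate eigenvectors of `U` (if
`r ≠ 0`) and of `|T|`, and thereby of every other `S_q` (`approxEigen_rpow`).

It remains to treat the points of the spectrum that are not approximate eigenvalues. The exponent
is moved from `1` to `2p` continuously, one coordinate at a time. If `S_q - r^q e^{iθ}`, restricted
to the joint approximate kernel of the other coordinates, changes between invertible and not
invertible at some `q`, then there it is a limit of invertible operators without being invertible,
so it is not bounded below and the point is an approximate eigenvalue; but then it is one for
all `q` (`hasJointApproxKernel_star_of_norm_sub_lt`, `IsPolarPHyponormal.hasJointApproxKernel_iff`).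
The restriction is expressed without passing to a larger space, through sequences of unit vectors
that are approximately annihilated by a self-adjoint operator `P` commuting with `S_q`.
-/

namespace TaylorSpectrum

open Filter Topology
open scoped ComplexConjugate InnerProductSpace

/-! ### Approximate eigenvectors and the functional calculus -/

section ApproximateEigenvectors

variable {H : Type*} [NormedAddCommGroup H] [InnerProductSpace ℂ H]

theorem re_inner_self (x : H) : (⟪x, x⟫_ℂ).re = ‖x‖ ^ 2 := by
  simpa using inner_self_eq_norm_sq (𝕜 := ℂ) x

theorem re_inner_le_of_le {A B : H →L[ℂ] H} (h : A ≤ B) (x : H) :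
    (⟪A x, x⟫_ℂ).re ≤ (⟪B x, x⟫_ℂ).re := by
  have := ((ContinuousLinearMap.le_def A B).1 h).re_inner_nonneg_left x
  simp only [sub_apply, inner_sub_left, map_sub] at this
  exact sub_nonneg.1 this

/-- The sequence `x` is a sequence of approximate eigenvectors of `T` for the value `z`:
`T xₖ - z xₖ → 0`. (Normalization of the `xₖ` is a separate hypothesis.) -/
def ApproxEigen (x : ℕ → H) (T : H →L[ℂ] H) (z : ℂ) : Prop :=
  Tendsto (fun k => T (x k) - z • x k) atTop (𝓝 0)

theorem approxEigen_iff {T : H →L[ℂ] H} {z : ℂ} {x : ℕ → H} : ApproxEigen x T z ↔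
    Tendsto (fun k => (T - z • (1 : H →L[ℂ] H)) (x k)) atTop (𝓝 0) := by
  simp [ApproxEigen]

theorem tendsto_clm_zero {y : ℕ → H} (L : H →L[ℂ] H) (h : Tendsto y atTop (𝓝 0)) :
    Tendsto (fun k => L (y k)) atTop (𝓝 0) := by
  have := (L.continuous.tendsto 0).comp h
  rwa [map_zero] at this

theorem tendsto_zero_of_norm_sq {V : Type*} [NormedAddCommGroup V] {y : ℕ → V}
    (h : Tendsto (fun k => ‖y k‖ ^ 2) atTop (𝓝 0)) : Tendsto y atTop (𝓝 0) := by
  have := h.sqrt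
  simp only [Real.sqrt_sq (norm_nonneg _), Real.sqrt_zero] at this
  exact tendsto_zero_iff_norm_tendsto_zero.2 this

theorem tendsto_inner_zero_left {x y : ℕ → H} {C : ℝ} (hx : ∀ k, ‖x k‖ ≤ C)
    (h : Tendsto y atTop (𝓝 0)) : Tendsto (fun k => (⟪y k, x k⟫_ℂ).re) atTop (𝓝 0) := by
  have h1 : Tendsto (fun k => ‖y k‖ * C) atTop (𝓝 0) := by simpa using h.norm.mul_const C
  refine squeeze_zero_norm (fun k => ?_) h1
  calc ‖(⟪y k, x k⟫_ℂ).re‖ ≤ ‖⟪y k, x k⟫_ℂ‖ := Complex.abs_re_le_norm _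
    _ ≤ ‖y k‖ * ‖x k‖ := norm_inner_le_norm _ _
    _ ≤ ‖y k‖ * C := by gcongr; exact hx k

theorem tendsto_inner_zero_right {x y : ℕ → H} {C : ℝ} (hx : ∀ k, ‖x k‖ ≤ C)
    (h : Tendsto y atTop (𝓝 0)) : Tendsto (fun k => (⟪x k, y k⟫_ℂ).re) atTop (𝓝 0) := by
  simpa only [← inner_conj_symm (x _) (y _), Complex.conj_re] using tendsto_inner_zero_left hx h

theorem ApproxEigen.mul {x : ℕ → H} {S T : H →L[ℂ] H} {a b : ℂ} (hS : ApproxEigen x S a)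
    (hT : ApproxEigen x T b) : ApproxEigen x (S * T) (a * b) := by
  have h := (tendsto_clm_zero S hT).add (hS.const_smul b)
  simp only [smul_zero, add_zero] at h
  refine h.congr fun k => ?_
  simp only [map_sub, map_smul, mul_apply_eq_comp, smul_sub, smul_smul, mul_comm b a]
  abel

/-- A nonzero approximate eigenvalue of `T` can be cancelled from one of `S * T`. -/
theorem ApproxEigen.of_mul {x : ℕ → H} {S T : H →L[ℂ] H} {a b : ℂ} (hb : b ≠ 0)
    (hT : ApproxEigen x T b) (hST : ApproxEigen x (S * T) (a * b)) : ApproxEigen x S a := by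
  have h := (hST.sub (tendsto_clm_zero S hT)).const_smul b⁻¹
  simp only [smul_zero, sub_zero] at h
  refine h.congr fun k => ?_
  simp only [map_sub, map_smul, mul_apply_eq_comp, smul_sub, smul_smul]
  rw [mul_comm a b, inv_mul_cancel_left₀ hb, inv_mul_cancel₀ hb, one_smul]
  abel

theorem ApproxEigen.norm_sq {x : ℕ → H} (hx : ∀ k, ‖x k‖ = 1) {T : H →L[ℂ] H} {z : ℂ}
    (h : ApproxEigen x T z) : Tendsto (fun k => ‖T (x k)‖ ^ 2) atTop (𝓝 (‖z‖ ^ 2)) := by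
  have h1 : Tendsto (fun k => ‖T (x k)‖ - ‖z‖) atTop (𝓝 0) := by
    refine squeeze_zero_norm (fun k => ?_) (by simpa using h.norm)
    have := abs_norm_sub_norm_le (T (x k)) (z • x k)
    rwa [norm_smul, hx k, mul_one] at this
  have h2 := (h1.add_const ‖z‖).pow 2
  simpa using h2

variable [CompleteSpace H]

theorem re_inner_star_mul_self (L : H →L[ℂ] H) (x : H) :
    (⟪(star L * L) x, x⟫_ℂ).re = ‖L x‖ ^ 2 := by
  have := ContinuousLinearMap.apply_norm_sq_eq_inner_adjoint_left L x
  rw [this, ContinuousLinearMap.star_eq_adjoint]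
  rfl

/-- The quadratic-form version of `f² ≤ ε + C g²` on the spectrum. -/
theorem norm_cfc_apply_sq_le {A : H →L[ℂ] H} (hA : IsSelfAdjoint A) {f g : ℝ → ℝ}
    (hf : Continuous f) (hg : Continuous g) {ε C : ℝ}
    (h : ∀ t ∈ spectrum ℝ A, f t ^ 2 ≤ ε + C * g t ^ 2) (x : H) :
    ‖cfc f A x‖ ^ 2 ≤ ε * ‖x‖ ^ 2 + C * ‖cfc g A x‖ ^ 2 := by
  have key : ∀ f : ℝ → ℝ, Continuous f →
      ‖cfc f A x‖ ^ 2 = (⟪cfc (fun t => f t ^ 2) A x, x⟫_ℂ).re := by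
    intro f hf
    have hsa : IsSelfAdjoint (cfc f A) := cfc_predicate f A
    rw [← re_inner_star_mul_self, hsa.star_eq, cfc_pow f 2 A, pow_two]
  have h1 : cfc (fun t => f t ^ 2) A ≤ cfc (fun t => ε + C * g t ^ 2) A :=
    cfc_mono h
  have h2 : cfc (fun t => ε + C * g t ^ 2) A
      = algebraMap ℝ _ ε + C • cfc (fun t => g t ^ 2) A := by
    rw [cfc_const_add ε (fun t => C * g t ^ 2) A, cfc_const_mul C (fun t => g t ^ 2) A]
  have h3 := re_inner_le_of_le h1 x
  have h4 : ∀ c : ℝ, ∀ y : H, (⟪c • y, x⟫_ℂ).re = c * (⟪y, x⟫_ℂ).re := by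
    intro c y
    rw [← Complex.coe_smul c y, inner_smul_left]
    simp
  rw [h2, add_apply, inner_add_left, Complex.add_re,
    smul_apply, h4, ← key f hf, ← key g hg, Algebra.algebraMap_eq_smul_one,
    smul_apply, h4, one_apply_eq_self] at h3
  rwa [re_inner_self] at h3

theorem cfc_sub_const_apply {A : H →L[ℂ] H} (hA : IsSelfAdjoint A) {f : ℝ → ℝ}
    (hf : Continuous f) (c : ℝ) (x : H) :
    cfc (fun t => f t - c) A x = cfc f A x - (c : ℂ) • x := by
  rw [cfc_sub f (fun _ => c) A, cfc_const c A, Algebra.algebraMap_eq_smul_one]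
  simp [Complex.coe_smul]

/-- Spectral mapping for normalized approximate eigenvectors of a self-adjoint operator: on the
compact spectrum, `(f t - f r)²` is at most `ε + C (t - r)²`, for every `ε` and a suitable `C`. -/
theorem ApproxEigen.cfc {x : ℕ → H} (hx : ∀ k, ‖x k‖ = 1) {A : H →L[ℂ] H}
    (hA : IsSelfAdjoint A) {r : ℝ} (h : ApproxEigen x A r) {f : ℝ → ℝ} (hf : Continuous f) :
    ApproxEigen x (cfc f A) (f r) := by
  have hcomp : IsCompact (spectrum ℝ A) := ContinuousFunctionalCalculus.isCompact_spectrum A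
  obtain ⟨M, hM⟩ := hcomp.exists_bound_of_continuousOn (f := fun t => f t - f r)
    (by fun_prop)
  rw [ApproxEigen, Metric.tendsto_atTop]
  intro ε hε
  obtain ⟨δ, hδ, hfδ⟩ := Metric.continuous_iff.1 hf r (ε / 2) (by positivity)
  have hpt : ∀ t ∈ spectrum ℝ A, (f t - f r) ^ 2 ≤ (ε / 2) ^ 2 + (M / δ) ^ 2 * (t - r) ^ 2 := by
    intro t ht
    by_cases hd : dist t r < δ
    · have := hfδ t hd
      rw [Real.dist_eq] at this
      have h2 : (f t - f r) ^ 2 ≤ (ε / 2) ^ 2 := by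
        rw [← sq_abs]; gcongr
      have : 0 ≤ (M / δ) ^ 2 * (t - r) ^ 2 := by positivity
      linarith
    · have h1 : δ ≤ |t - r| := by rw [← Real.dist_eq]; exact not_lt.1 hd
      have h2 : (f t - f r) ^ 2 ≤ M ^ 2 := by
        rw [← sq_abs]; gcongr; exact hM t ht
      have h3 : δ ^ 2 ≤ (t - r) ^ 2 := by rw [← sq_abs (t - r)]; gcongr
      have h4 : M ^ 2 ≤ (M / δ) ^ 2 * (t - r) ^ 2 := by
        rw [div_pow, div_mul_eq_mul_div, le_div_iff₀ (by positivity)]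
        gcongr
      nlinarith [sq_nonneg (ε / 2)]
  have hz : Tendsto (fun k => (M / δ) ^ 2 * ‖A (x k) - (r : ℂ) • x k‖ ^ 2) atTop (𝓝 0) := by
    simpa using (h.norm.pow 2).const_mul ((M / δ) ^ 2)
  obtain ⟨N, hN⟩ := Metric.tendsto_atTop.1 hz (ε ^ 2 / 2) (by positivity)
  refine ⟨N, fun k hk => ?_⟩
  have h1 := norm_cfc_apply_sq_le hA (f := fun t => f t - f r) (g := fun t => t - r)
    (by fun_prop) (by fun_prop) hpt (x k)
  rw [cfc_sub_const_apply hA hf, cfc_sub_const_apply hA continuous_id', cfc_id' ℝ A, hx k] at h1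
  have h2 := hN k hk
  rw [Real.dist_eq, sub_zero, abs_of_nonneg (by positivity)] at h2
  rw [dist_zero_right]
  refine lt_of_pow_lt_pow_left₀ 2 hε.le ?_
  nlinarith [sq_pos_of_pos hε]

theorem continuous_rpow_const_of_pos {s : ℝ} (hs : 0 < s) : Continuous fun t : ℝ => t ^ s :=
  Real.continuous_rpow_const hs.le

/-- Approximate eigenvectors of one positive power of a positive operator are approximate
eigenvectors of every other one. -/
theorem ApproxEigen.rpow {x : ℕ → H} (hx : ∀ k, ‖x k‖ = 1) {A : H →L[ℂ] H} (hA : 0 ≤ A)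
    {r s t : ℝ} (hr : 0 ≤ r) (hs : 0 < s) (ht : 0 < t)
    (h : ApproxEigen x (A ^ s) ((r ^ s : ℝ) : ℂ)) :
    ApproxEigen x (A ^ t) ((r ^ t : ℝ) : ℂ) := by
  have h1 := h.cfc hx (IsSelfAdjoint.of_nonneg CFC.rpow_nonneg)
    (continuous_rpow_const_of_pos (div_pos ht hs))
  rw [← CFC.rpow_eq_cfc_real (CFC.rpow_nonneg),
    CFC.rpow_rpow_of_exponent_nonneg A s (t / s) hs.le (by positivity),
    ← Real.rpow_mul hr, mul_div_cancel₀ t hs.ne'] at h1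
  exact h1

end ApproximateEigenvectors

/-! ### Powers of the modulus of a `p`-hyponormal operator -/

section Modulus

variable {H : Type*} [NormedAddCommGroup H] [InnerProductSpace ℂ H] [CompleteSpace H]

/-- The operators `U` and `A` are the factors of a `p`-hyponormal operator `T = U A`: `U` is
unitary, `A` is positive, and `(T T*)ᵖ = U A²ᵖ U* ≤ A²ᵖ = (T* T)ᵖ`. -/
structure IsPolarPHyponormal (p : ℝ) (U A : H →L[ℂ] H) : Prop where
  unitary : U ∈ unitary (H →L[ℂ] H)
  nonneg : 0 ≤ A
  le : U * A ^ (2 * p) * star U ≤ A ^ (2 * p)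

theorem rpow_mul_rpow {A : H →L[ℂ] H} (hA : 0 ≤ A) {s t : ℝ} (hs : 0 < s) (ht : 0 < t) :
    A ^ s * A ^ t = A ^ (s + t) := by
  rw [CFC.rpow_eq_cfc_real hA, CFC.rpow_eq_cfc_real hA, CFC.rpow_eq_cfc_real hA,
    ← cfc_mul _ _ A (continuous_rpow_const_of_pos hs).continuousOn
      (continuous_rpow_const_of_pos ht).continuousOn]
  refine cfc_congr fun a ha => ?_
  exact (Real.rpow_add_of_nonneg (spectrum_nonneg_of_nonneg hA ha) hs.le ht.le).symm

theorem isSelfAdjoint_rpow {A : H →L[ℂ] H} {s : ℝ} : IsSelfAdjoint (A ^ s) :=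
  .of_nonneg CFC.rpow_nonneg

theorem exists_nonneg_norm_eq_rpow (z : ℂ) {q : ℝ} (hq : 0 < q) : ∃ r : ℝ, 0 ≤ r ∧ ‖z‖ = r ^ q :=
  ⟨‖z‖ ^ q⁻¹, by positivity, (Real.rpow_inv_rpow (norm_nonneg z) hq.ne').symm⟩

/-- The pointwise association inequality `0 ≤ (f t - f r) (g t - g r)` for increasing `f`, `g`, in a
quantitative form. -/
theorem rpow_sub_sq_le {q p r t : ℝ} (hp : 0 < p) (hq : p ≤ q) (hr : 0 ≤ r)
    (ht : 0 ≤ t) :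
    r ^ (2 * (q - p)) * (t ^ (2 * p) - r ^ (2 * p)) ^ 2 ≤
      (t ^ (2 * q) - r ^ (2 * q)) * (t ^ (2 * p) - r ^ (2 * p)) := by
  have h1 : t ^ (2 * q) = t ^ (2 * (q - p)) * t ^ (2 * p) := by
    rw [← Real.rpow_add_of_nonneg ht (by linarith) (by linarith)]; ring_nf
  have h2 : r ^ (2 * q) = r ^ (2 * (q - p)) * r ^ (2 * p) := by
    rw [← Real.rpow_add_of_nonneg hr (by linarith) (by linarith)]; ring_nf
  have h3 : 0 ≤ (t ^ (2 * (q - p)) - r ^ (2 * (q - p))) * (t ^ (2 * p) - r ^ (2 * p)) := by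
    rcases le_total r t with h | h
    · exact mul_nonneg (sub_nonneg.2 (Real.rpow_le_rpow hr h (by linarith)))
        (sub_nonneg.2 (Real.rpow_le_rpow hr h (by linarith)))
    · exact mul_nonneg_of_nonpos_of_nonpos
        (sub_nonpos.2 (Real.rpow_le_rpow ht h (by linarith)))
        (sub_nonpos.2 (Real.rpow_le_rpow ht h (by linarith)))
  have h4 : 0 ≤ t ^ (2 * p) := Real.rpow_nonneg ht _
  rw [h1, h2]
  nlinarith [mul_nonneg h4 h3]

/-- The operator form of `rpow_sub_sq_le`. -/
theorem rpow_sub_mul_rpow_sub_le {A : H →L[ℂ] H} (hA : 0 ≤ A) {q p r : ℝ} (hp : 0 < p)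
    (hq : p ≤ q) (hr : 0 ≤ r) :
    r ^ (2 * (q - p)) • (A ^ (2 * p) - algebraMap ℝ (H →L[ℂ] H) (r ^ (2 * p))) ^ 2 ≤
      (A ^ (2 * q) - algebraMap ℝ (H →L[ℂ] H) (r ^ (2 * q))) *
        (A ^ (2 * p) - algebraMap ℝ (H →L[ℂ] H) (r ^ (2 * p))) := by
  have hsub : ∀ s : ℝ, 0 < s → ∀ c : ℝ,
      A ^ s - algebraMap ℝ (H →L[ℂ] H) c = cfc (fun t : ℝ => t ^ s - c) A := fun s hs c => by
    rw [cfc_sub (fun t : ℝ => t ^ s) (fun _ => c) A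
      (continuous_rpow_const_of_pos hs).continuousOn, cfc_const c A, CFC.rpow_eq_cfc_real hA]
  have c1 : ContinuousOn (fun t : ℝ => t ^ (2 * p) - r ^ (2 * p)) (spectrum ℝ A) :=
    ((continuous_rpow_const_of_pos (by linarith)).sub continuous_const).continuousOn
  have c2 : ContinuousOn (fun t : ℝ => t ^ (2 * q) - r ^ (2 * q)) (spectrum ℝ A) :=
    ((continuous_rpow_const_of_pos (by linarith)).sub continuous_const).continuousOn
  rw [hsub _ (by linarith), hsub _ (by linarith), ← cfc_pow _ 2 A c1, ← cfc_mul _ _ A c2 c1,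
    ← cfc_const_mul _ (fun t : ℝ => (t ^ (2 * p) - r ^ (2 * p)) ^ 2) A (c1.pow 2)]
  exact cfc_mono (fun t ht =>
    rpow_sub_sq_le hp hq hr (spectrum_nonneg_of_nonneg hA ht))
    (continuousOn_const.mul (c1.pow 2)) (c2.mul c1)

namespace IsPolarPHyponormal

variable {p : ℝ} {U A : H →L[ℂ] H}

theorem norm_unitary_apply (h : IsPolarPHyponormal p U A) (x : H) : ‖U x‖ = ‖x‖ := by
  have h1 := re_inner_star_mul_self U x
  rw [(Unitary.mem_iff.1 h.unitary).1, one_apply_eq_self, re_inner_self] at h1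
  exact ((sq_eq_sq₀ (norm_nonneg _) (norm_nonneg _)).1 h1).symm

theorem star_mul_self (h : IsPolarPHyponormal p U A) {q : ℝ} (hq : 0 < q) :
    star (U * A ^ q) * (U * A ^ q) = A ^ (2 * q) := by
  rw [star_mul, isSelfAdjoint_rpow.star_eq, mul_assoc, ← mul_assoc (star U),
    (Unitary.mem_iff.1 h.unitary).1, one_mul, rpow_mul_rpow h.nonneg hq hq, two_mul]

/-- The approximate eigenvectors of `U A^q` for a value of modulus `r^q` are approximate
eigenvectors of `A²ᵖ` for the value `r²ᵖ`.

In a spectral representation of `A` at the `xₖ`, the inequality `U A²ᵖ U* ≤ A²ᵖ` says that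
`∫ t^(2p+2q) ≤ r^(2q) ∫ t^(2p)` in the limit, whereas `∫ t^(2q) = r^(2q)`; by the association
inequality of Chebyshev this leaves no variance. -/
theorem approxEigen_modulus_of_pos (h : IsPolarPHyponormal p U A) (hp : 0 < p) {q r : ℝ}
    (hq : p ≤ q) (hr : 0 < r) {x : ℕ → H} (hx : ∀ k, ‖x k‖ = 1) {z : ℂ} (hz : ‖z‖ = r ^ q)
    (hS : ApproxEigen x (U * A ^ q) z) :
    ApproxEigen x (A ^ (2 * p)) ((r ^ (2 * p) : ℝ) : ℂ) := by
  have hq0 : 0 < q := hp.trans_le hq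
  have hA := h.nonneg
  set S := U * A ^ q with hSdef
  set B := A ^ (2 * p) with hB
  set B' := U * B * star U with hB'
  have hBsa : IsSelfAdjoint B := isSelfAdjoint_rpow
  set a := r ^ (2 * p) with ha
  have hd : ‖z‖ ^ 2 = r ^ (2 * q) := by
    rw [hz, ← Real.rpow_natCast, ← Real.rpow_mul hr.le]; ring_nf
  have hSB : S * B = B' * S := by
    rw [hB', hSdef, mul_assoc (U * B), ← mul_assoc (star U), (Unitary.mem_iff.1 h.unitary).1,
      one_mul, mul_assoc, mul_assoc, hB, rpow_mul_rpow hA hq0 (by linarith),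
      rpow_mul_rpow hA (by linarith) hq0, add_comm]
  -- `rpow_sub_sq_le` at `y`; by `S B = B' S` and `B' ≤ B` the right-hand side involves `B'` only
  have hbound : ∀ y : H, ‖y‖ = 1 → r ^ (2 * (q - p)) * ‖B y - (a : ℂ) • y‖ ^ 2 ≤
      ((⟪B' (S y), S y⟫_ℂ).re - ‖z‖ ^ 2 * (⟪B' y, y⟫_ℂ).re) - a * (‖S y‖ ^ 2 - ‖z‖ ^ 2) := by
    intro y hy
    have hle := rpow_sub_mul_rpow_sub_le hA hp hq hr.le
    rw [← h.star_mul_self hq0, ← hSdef, ← hB, ← ha] at hle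
    have hle2 := re_inner_le_of_le hle y
    have hsa : IsSelfAdjoint (B - algebraMap ℝ (H →L[ℂ] H) a) :=
      hBsa.sub (IsSelfAdjoint.algebraMap _ (IsSelfAdjoint.all a))
    have happ : (B - algebraMap ℝ (H →L[ℂ] H) a) y = B y - (a : ℂ) • y := by
      rw [Algebra.algebraMap_eq_smul_one]
      simp [Complex.coe_smul]
    have hyy : (⟪y, y⟫_ℂ).re = 1 := by rw [re_inner_self, hy, one_pow]
    have hL : (⟪(r ^ (2 * (q - p)) • (B - algebraMap ℝ (H →L[ℂ] H) a) ^ 2) y, y⟫_ℂ).re =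
        r ^ (2 * (q - p)) * ‖B y - (a : ℂ) • y‖ ^ 2 := by
      rw [← happ, ← re_inner_star_mul_self, hsa.star_eq, ← pow_two, smul_apply,
        ← Complex.coe_smul, inner_smul_left, Complex.conj_ofReal, Complex.re_ofReal_mul]
    have hSS : ∀ v w : H, ⟪(star S * S) v, w⟫_ℂ = ⟪S v, S w⟫_ℂ := fun v w => by
      rw [ContinuousLinearMap.star_eq_adjoint, mul_apply_eq_comp,
        ContinuousLinearMap.adjoint_inner_left]
    have hSBy : S (B y) = B' (S y) := by
      have := congrArg (fun L : H →L[ℂ] H => L y) hSB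
      simpa using this
    have hR : (⟪((star S * S - algebraMap ℝ (H →L[ℂ] H) (r ^ (2 * q))) *
          (B - algebraMap ℝ (H →L[ℂ] H) a)) y, y⟫_ℂ).re =
        ((⟪B' (S y), S y⟫_ℂ).re - ‖z‖ ^ 2 * (⟪B y, y⟫_ℂ).re) - a * (‖S y‖ ^ 2 - ‖z‖ ^ 2) := by
      rw [mul_apply_eq_comp, happ, sub_apply, inner_sub_left, hSS, map_sub, map_smul,
        inner_sub_left, hSBy, Algebra.algebraMap_eq_smul_one, smul_apply, one_apply_eq_self,
        ← Complex.coe_smul, inner_smul_left, inner_smul_left, inner_sub_left, inner_smul_left,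
        hd, Complex.sub_re, Complex.sub_re, Complex.conj_ofReal, Complex.conj_ofReal,
        Complex.re_ofReal_mul, Complex.re_ofReal_mul, Complex.sub_re, Complex.re_ofReal_mul, hyy]
      rw [re_inner_self]
      ring
    rw [hL, hR] at hle2
    have hBB := re_inner_le_of_le h.le y
    have := mul_le_mul_of_nonneg_left hBB (sq_nonneg ‖z‖)
    linarith
  have hlim1 : Tendsto (fun k => (⟪B' (S (x k)), S (x k)⟫_ℂ).re -
      ‖z‖ ^ 2 * (⟪B' (x k), x k⟫_ℂ).re) atTop (𝓝 0) := by
    have t1 := tendsto_inner_zero_right (x := fun k => B' (S (x k))) (C := ‖B' * S‖)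
      (fun k => by simpa [hx k] using (B' * S).le_opNorm (x k)) hS
    have t2 := tendsto_inner_zero_left (x := fun k => z • x k) (C := ‖z‖)
      (fun k => by rw [norm_smul, hx k, mul_one]) (tendsto_clm_zero B' hS)
    have t3 := t1.add t2
    rw [add_zero] at t3
    refine t3.congr fun k => ?_
    have : ((‖z‖ ^ 2 : ℝ) : ℂ) = z * conj z := by rw [Complex.mul_conj, Complex.normSq_eq_norm_sq]
    rw [← Complex.re_ofReal_mul, this, ← Complex.add_re, ← Complex.sub_re]
    congr 1
    simp only [map_sub, map_smul, inner_sub_left, inner_sub_right, inner_smul_left,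
      inner_smul_right]
    ring
  have hlim2 : Tendsto (fun k => a * (‖S (x k)‖ ^ 2 - ‖z‖ ^ 2)) atTop (𝓝 0) := by
    have := ((hS.norm_sq hx).sub_const (‖z‖ ^ 2)).const_mul a
    rwa [sub_self, mul_zero] at this
  have hlim := hlim1.sub hlim2
  rw [sub_zero] at hlim
  have hsq : Tendsto (fun k => r ^ (2 * (q - p)) * ‖B (x k) - (a : ℂ) • x k‖ ^ 2) atTop (𝓝 0) :=
    squeeze_zero (fun k => by positivity) (fun k => hbound (x k) (hx k)) hlim
  have hpos : 0 < r ^ (2 * (q - p)) := Real.rpow_pos_of_pos hr _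
  have hsq2 := hsq.const_mul (r ^ (2 * (q - p)))⁻¹
  simp only [inv_mul_cancel_left₀ hpos.ne', mul_zero] at hsq2
  exact tendsto_zero_of_norm_sq hsq2

/-- Approximate eigenvectors of `U A^q` are approximate eigenvectors of its modulus. -/
theorem approxEigen_modulus (h : IsPolarPHyponormal p U A) (hp : 0 < p) {q r : ℝ}
    (hq : p ≤ q) (hr : 0 ≤ r) {x : ℕ → H} (hx : ∀ k, ‖x k‖ = 1) {z : ℂ} (hz : ‖z‖ = r ^ q)
    (hS : ApproxEigen x (U * A ^ q) z) {s : ℝ} (hs : 0 < s) :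
    ApproxEigen x (A ^ s) ((r ^ s : ℝ) : ℂ) := by
  have hq0 : 0 < q := hp.trans_le hq
  rcases hr.eq_or_lt with rfl | hr'
  · refine ApproxEigen.rpow hx h.nonneg hr hq0 hs ?_
    rw [Real.zero_rpow hq0.ne', norm_eq_zero] at hz
    rw [Real.zero_rpow hq0.ne']
    subst hz
    simp only [ApproxEigen, zero_smul, sub_zero, Complex.ofReal_zero] at hS ⊢
    rw [tendsto_zero_iff_norm_tendsto_zero] at hS ⊢
    simpa [h.norm_unitary_apply] using hS
  · exact (h.approxEigen_modulus_of_pos hp hq hr' hx hz hS).rpow hx h.nonneg hr (by linarith) hs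

/-- Approximate eigenvectors of `U A^q` for the value `z` are approximate eigenvectors of its
adjoint for `conj z`. -/
theorem approxEigen_star (h : IsPolarPHyponormal p U A) (hp : 0 < p) {q : ℝ}
    (hq : p ≤ q) {x : ℕ → H} (hx : ∀ k, ‖x k‖ = 1) {z : ℂ}
    (hS : ApproxEigen x (U * A ^ q) z) : ApproxEigen x (star (U * A ^ q)) (conj z) := by
  have hq0 : 0 < q := hp.trans_le hq
  obtain ⟨r, hr, hz⟩ := exists_nonneg_norm_eq_rpow z hq0
  by_cases hz0 : z = 0
  · subst hz0
    have hB := h.approxEigen_modulus hp hq hr hx hz hS (s := 2 * p) (by linarith)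
    have hr0 : r = 0 := by
      rw [norm_zero] at hz
      exact ((Real.rpow_eq_zero_iff_of_nonneg hr).1 hz.symm).1
    subst hr0
    rw [Real.zero_rpow (by linarith)] at hB
    -- `‖Aᵖ U* x‖² = ⟪U A²ᵖ U* x, x⟫ ≤ ⟪A²ᵖ x, x⟫ → 0`, and `U* x` is again normalized
    have hnorm : ∀ k, ‖star U (x k)‖ = 1 := by
      intro k
      have h1 := re_inner_star_mul_self (star U) (x k)
      rw [star_star, (Unitary.mem_iff.1 h.unitary).2, one_apply_eq_self] at h1
      rw [re_inner_self, hx k, one_pow] at h1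
      exact (pow_eq_one_iff_of_nonneg (norm_nonneg _) two_ne_zero).1 h1.symm
    have hle : ∀ k, ‖(A ^ p) (star U (x k))‖ ^ 2 ≤ (⟪(A ^ (2 * p)) (x k), x k⟫_ℂ).re := by
      intro k
      refine le_trans (le_of_eq ?_) (re_inner_le_of_le h.le (x k))
      have h1 := re_inner_star_mul_self (A ^ p * star U) (x k)
      change _ = ‖(A ^ p) (star U (x k))‖ ^ 2 at h1
      rw [← h1, star_mul, star_star, isSelfAdjoint_rpow.star_eq, mul_assoc, ← mul_assoc (A ^ p),
        rpow_mul_rpow h.nonneg hp hp, ← two_mul, mul_assoc]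
    have hB0 : Tendsto (fun k => (A ^ (2 * p)) (x k)) atTop (𝓝 0) := by
      simpa [ApproxEigen] using hB
    have hlim := squeeze_zero (fun k => sq_nonneg _) hle
      (tendsto_inner_zero_left (fun k => (hx k).le) hB0)
    have hAp : ApproxEigen (fun k => star U (x k)) (A ^ p) (((0 : ℝ) ^ p : ℝ) : ℂ) := by
      simpa [ApproxEigen, Real.zero_rpow hp.ne'] using tendsto_zero_of_norm_sq hlim
    have hAq := hAp.rpow hnorm h.nonneg le_rfl hp hq0
    rw [star_mul, isSelfAdjoint_rpow.star_eq]
    simpa [ApproxEigen, Real.zero_rpow hq0.ne'] using hAq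
  · refine ApproxEigen.of_mul hz0 hS ?_
    rw [h.star_mul_self hq0]
    convert h.approxEigen_modulus hp hq hr hx hz hS (s := 2 * q) (by linarith) using 1
    rw [mul_comm, Complex.mul_conj, Complex.normSq_eq_norm_sq, hz, ← Real.rpow_natCast,
      ← Real.rpow_mul hr]
    norm_num [mul_comm]

/-- Approximate eigenvectors of `U A^q` are approximate eigenvectors of all `U A^{q'}`. -/
theorem approxEigen_rpow (h : IsPolarPHyponormal p U A) (hp : 0 < p) {q q' r : ℝ}
    (hq : p ≤ q) (hq' : 0 < q') (hr : 0 ≤ r) {x : ℕ → H} (hx : ∀ k, ‖x k‖ = 1) {e : ℂ}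
    (he : ‖e‖ = 1) (hS : ApproxEigen x (U * A ^ q) ((r ^ q : ℝ) * e)) :
    ApproxEigen x (U * A ^ q') ((r ^ q' : ℝ) * e) := by
  have hq0 : 0 < q := hp.trans_le hq
  have hz : ‖((r ^ q : ℝ) : ℂ) * e‖ = r ^ q := by
    rw [norm_mul, he, mul_one, Complex.norm_real, Real.norm_of_nonneg (Real.rpow_nonneg hr q)]
  have hA1 := h.approxEigen_modulus hp hq hr hx hz hS hq0
  have hA2 := h.approxEigen_modulus hp hq hr hx hz hS hq'
  rcases hr.eq_or_lt with rfl | hr'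
  · simp only [ApproxEigen, Real.zero_rpow hq'.ne', Complex.ofReal_zero, zero_mul, zero_smul,
      sub_zero] at hA2 ⊢
    exact tendsto_clm_zero U hA2
  · have hne : ((r ^ q : ℝ) : ℂ) ≠ 0 := by
      exact_mod_cast (Real.rpow_pos_of_pos hr' q).ne'
    rw [mul_comm] at hS
    have hU : ApproxEigen x U e := ApproxEigen.of_mul hne hA1 hS
    rw [mul_comm (_ : ℂ) e]
    exact hU.mul hA2

end IsPolarPHyponormal

end Modulus

/-! ### Joint approximate kernels -/

section Exponent

variable {H : Type*} [NormedAddCommGroup H] [InnerProductSpace ℂ H]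

/-- The value `0` belongs to the joint approximate point spectrum of the family `L`: some sequence
of unit vectors is mapped to a null sequence by every `L i`. -/
def HasJointApproxKernel {ι : Type*} (L : ι → H →L[ℂ] H) : Prop :=
  ∃ x : ℕ → H, (∀ k, ‖x k‖ = 1) ∧ ∀ i, Tendsto (fun k => L i (x k)) atTop (𝓝 0)

theorem exists_lower_bound_of_not_hasJointApproxKernel {ι : Type*} [Fintype ι]
    {L : ι → H →L[ℂ] H} (h : ¬ HasJointApproxKernel L) :
    ∃ c : ℝ, 0 < c ∧ ∀ x, c * ‖x‖ ^ 2 ≤ ∑ i, ‖L i x‖ ^ 2 := by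
  by_contra! hcon
  apply h
  choose y hy using fun k : ℕ => hcon (1 / ((k : ℝ) + 1)) (by positivity)
  have hy0 : ∀ k, 0 < ‖y k‖ := by
    intro k
    rw [norm_pos_iff]
    intro h0
    have := hy k
    simp [h0] at this
  refine ⟨fun k => ((‖y k‖⁻¹ : ℝ) : ℂ) • y k, fun k => ?_, fun i => ?_⟩
  · rw [norm_smul, Complex.norm_real, Real.norm_of_nonneg (by positivity),
      inv_mul_cancel₀ (hy0 k).ne']
  · have hsq : Tendsto (fun k => ‖L i (((‖y k‖⁻¹ : ℝ) : ℂ) • y k)‖ ^ 2) atTop (𝓝 0) := by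
      refine squeeze_zero (fun k => sq_nonneg _) (fun k => ?_)
        tendsto_one_div_add_atTop_nhds_zero_nat
      have h1 : ‖L i (y k)‖ ^ 2 ≤ 1 / ((k : ℝ) + 1) * ‖y k‖ ^ 2 :=
        (Finset.single_le_sum (f := fun i => ‖L i (y k)‖ ^ 2) (fun i _ => sq_nonneg _)
          (Finset.mem_univ i)).trans (hy k).le
      rw [map_smul, norm_smul, Complex.norm_real, Real.norm_of_nonneg (by positivity), mul_pow,
        inv_pow, inv_mul_le_iff₀ (pow_pos (hy0 k) 2), mul_comm]
      exact h1
    exact tendsto_zero_of_norm_sq hsq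

theorem not_hasJointApproxKernel_of_norm_sub_lt {L₀ L P : H →L[ℂ] H} {c : ℝ}
    (hc : ∀ x, c * ‖x‖ ^ 2 ≤ ‖L₀ x‖ ^ 2 + ‖P x‖ ^ 2) (hL : ‖L - L₀‖ ^ 2 < c) :
    ¬ HasJointApproxKernel ![L, P] := by
  rintro ⟨x, hx, h⟩
  have hx1 : Tendsto (fun k => L (x k)) atTop (𝓝 0) := h 0
  have hx2 : Tendsto (fun k => P (x k)) atTop (𝓝 0) := h 1
  have hl : Tendsto (fun k => (‖L (x k)‖ + ‖L - L₀‖) ^ 2 + ‖P (x k)‖ ^ 2) atTop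
      (𝓝 ((‖(0 : H)‖ + ‖L - L₀‖) ^ 2 + ‖(0 : H)‖ ^ 2)) :=
    ((hx1.norm.add_const _).pow 2).add (hx2.norm.pow 2)
  have h1 : c ≤ (‖(0 : H)‖ + ‖L - L₀‖) ^ 2 + ‖(0 : H)‖ ^ 2 := by
    refine ge_of_tendsto' hl fun k => ?_
    have h2 := hc (x k)
    rw [hx k, one_pow, mul_one] at h2
    have h3 : ‖L₀ (x k)‖ ≤ ‖L (x k)‖ + ‖L - L₀‖ := by
      have h4 : L₀ (x k) = L (x k) - (L - L₀) (x k) := by simp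
      rw [h4]
      refine (norm_sub_le _ _).trans ?_
      gcongr
      refine ((L - L₀).le_opNorm _).trans ?_
      rw [hx k, mul_one]
    refine h2.trans ?_
    gcongr
  simp only [norm_zero, zero_add] at h1
  nlinarith

variable [CompleteSpace H]

theorem isUnit_sum_star_mul_self {ι : Type*} [Fintype ι] {L : ι → H →L[ℂ] H}
    (h : ¬ HasJointApproxKernel L) : IsUnit (∑ i, star (L i) * L i) := by
  obtain ⟨c, hc, hb⟩ := exists_lower_bound_of_not_hasJointApproxKernel h
  refine ContinuousLinearMap.isUnit_of_forall_le_norm_inner_map _ (c := ⟨c, hc.le⟩) hc fun x => ?_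
  refine le_trans ?_ (Complex.re_le_norm _)
  rw [sum_apply, sum_inner, Complex.re_sum]
  simp only [re_inner_star_mul_self]
  rw [mul_comm]
  exact hb x

/-- Perturbation of a joint approximate kernel. Let `P` commute with `R`, and let `(R₀, P)` be
bounded below with constant `c`. If `(R₀*, P)` has a joint approximate kernel, then so does
`(R*, P)` for all `R` near `R₀`.

On the approximate kernel of `P`, this says that a limit of invertible operators which is bounded
below is invertible. -/
theorem hasJointApproxKernel_star_of_norm_sub_lt {R₀ R P : H →L[ℂ] H} (hP : IsSelfAdjoint P)
    (hPR : Commute P R) {c : ℝ} (hc : ∀ x, c * ‖x‖ ^ 2 ≤ ‖R₀ x‖ ^ 2 + ‖P x‖ ^ 2)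
    (hR : 4 * ‖R - R₀‖ ^ 2 < c) (h : HasJointApproxKernel ![star R₀, P]) :
    HasJointApproxKernel ![star R, P] := by
  by_contra hcon
  obtain ⟨x, hx, hL⟩ := h
  have hx1 : Tendsto (fun k => star R₀ (x k)) atTop (𝓝 0) := hL 0
  have hx2 : Tendsto (fun k => P (x k)) atTop (𝓝 0) := hL 1
  have hPR' : Commute P (star R) := by
    have := hPR.star_star
    rwa [hP.star_eq] at this
  obtain ⟨u, hu⟩ := isUnit_sum_star_mul_self hcon
  have hu' : (u : H →L[ℂ] H) = R * star R + P * P := by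
    rw [hu, Fin.sum_univ_two]
    simp [hP.star_eq]
  set V : H →L[ℂ] H := ((u⁻¹ : (H →L[ℂ] H)ˣ) : H →L[ℂ] H) with hV
  have hPu : Commute P (u : H →L[ℂ] H) := by
    rw [hu']
    exact (hPR.mul_right hPR').add_right ((Commute.refl P).mul_right (Commute.refl P))
  have hPV : Commute P V := hPu.units_inv_right
  have hdecomp : R * (star R * V) + V * P * P = 1 := by
    have h1 : (u : H →L[ℂ] H) * V = 1 := u.mul_inv
    rw [hu', add_mul] at h1
    rw [← h1, ← mul_assoc, ← hPV.eq, mul_assoc P V P, ← hPV.eq, mul_assoc P P V]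
  have hdecomp' : ∀ v, R ((star R * V) v) = v - V (P (P v)) := fun v => by
    have := congrArg (fun L : H →L[ℂ] H => L v) hdecomp
    simp only [add_apply, mul_apply_eq_comp, one_apply_eq_self] at this ⊢
    exact eq_sub_of_add_eq this
  -- approximate preimages `yₖ` of the `xₖ` under `R`
  set y : ℕ → H := fun k => (star R * V) (x k) with hy
  have hVPP : Tendsto (fun k => V (P (P (x k)))) atTop (𝓝 0) :=
    tendsto_clm_zero V (tendsto_clm_zero P hx2)
  have hPy : Tendsto (fun k => P (y k)) atTop (𝓝 0) := by
    have := tendsto_clm_zero (star R * V) hx2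
    refine this.congr fun k => ?_
    have := congrArg (fun L : H →L[ℂ] H => L (x k)) (hPR'.mul_right hPV).eq
    simpa [hy] using this.symm
  have hRy : Tendsto (fun k => ‖R (y k)‖) atTop (𝓝 1) := by
    have h1 : Tendsto (fun k => ‖R (y k)‖ - 1) atTop (𝓝 0) := by
      refine squeeze_zero_norm (fun k => ?_) (by simpa using hVPP.norm)
      have h2 : ‖R (y k)‖ = ‖x k - V (P (P (x k)))‖ := by rw [← hdecomp' (x k)]
      rw [h2, ← hx k]
      refine (abs_norm_sub_norm_le _ _).trans ?_
      simp
    simpa using h1.add_const 1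
  have hinner : Tendsto (fun k => (⟪R (y k), x k⟫_ℂ).re) atTop (𝓝 1) := by
    have h1 := (tendsto_inner_zero_left (fun k => (hx k).le) hVPP).const_sub 1
    rw [sub_zero] at h1
    refine h1.congr fun k => ?_
    have h2 : R (y k) = x k - V (P (P (x k))) := hdecomp' (x k)
    have h3 : (⟪x k, x k⟫_ℂ).re = 1 := by rw [re_inner_self, hx k, one_pow]
    rw [h2, inner_sub_left, Complex.sub_re, h3]
  set η := ‖R - R₀‖ with hη
  have hηs : ‖star R - star R₀‖ = η := by rw [← star_sub, norm_star]
  have hstep : ∀ k, (⟪R (y k), x k⟫_ℂ).re ^ 2 * (c - 2 * η ^ 2) ≤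
      (2 * ‖R (y k)‖ ^ 2 + ‖P (y k)‖ ^ 2) * (‖star R₀ (x k)‖ + η) ^ 2 := by
    intro k
    have h1 : ‖R₀ (y k)‖ ≤ ‖R (y k)‖ + η * ‖y k‖ := by
      have h2 : R₀ (y k) = R (y k) - (R - R₀) (y k) := by simp
      rw [h2]
      exact (norm_sub_le _ _).trans (by gcongr; exact (R - R₀).le_opNorm _)
    have h3 : ‖star R (x k)‖ ≤ ‖star R₀ (x k)‖ + η := by
      have h2 : star R (x k) = star R₀ (x k) + (star R - star R₀) (x k) := by simp
      rw [h2]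
      refine (norm_add_le _ _).trans ?_
      gcongr
      refine ((star R - star R₀).le_opNorm _).trans ?_
      rw [hx k, hηs, mul_one]
    have h4 : (c - 2 * η ^ 2) * ‖y k‖ ^ 2 ≤ 2 * ‖R (y k)‖ ^ 2 + ‖P (y k)‖ ^ 2 := by
      have h5 := hc (y k)
      have h6 : ‖R₀ (y k)‖ ^ 2 ≤ (‖R (y k)‖ + η * ‖y k‖) ^ 2 := by gcongr
      nlinarith [sq_nonneg (‖R (y k)‖ - η * ‖y k‖)]
    have h7 : (⟪R (y k), x k⟫_ℂ).re ^ 2 ≤ ‖y k‖ ^ 2 * (‖star R₀ (x k)‖ + η) ^ 2 := by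
      have h8 : ⟪R (y k), x k⟫_ℂ = ⟪y k, star R (x k)⟫_ℂ := by
        rw [ContinuousLinearMap.star_eq_adjoint, ContinuousLinearMap.adjoint_inner_right]
      rw [← mul_pow, ← sq_abs]
      gcongr
      calc |(⟪R (y k), x k⟫_ℂ).re| ≤ ‖⟪y k, star R (x k)⟫_ℂ‖ := by
            rw [← h8]; exact Complex.abs_re_le_norm _
        _ ≤ ‖y k‖ * ‖star R (x k)‖ := norm_inner_le_norm _ _
        _ ≤ _ := by gcongr
    have h9 : 0 ≤ c - 2 * η ^ 2 := by nlinarith [sq_nonneg η]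
    calc (⟪R (y k), x k⟫_ℂ).re ^ 2 * (c - 2 * η ^ 2)
        ≤ (‖y k‖ ^ 2 * (‖star R₀ (x k)‖ + η) ^ 2) * (c - 2 * η ^ 2) := by gcongr
      _ = ((c - 2 * η ^ 2) * ‖y k‖ ^ 2) * (‖star R₀ (x k)‖ + η) ^ 2 := by ring
      _ ≤ _ := by gcongr
  have hl1 : Tendsto (fun k => (⟪R (y k), x k⟫_ℂ).re ^ 2 * (c - 2 * η ^ 2)) atTop
      (𝓝 (1 ^ 2 * (c - 2 * η ^ 2))) := (hinner.pow 2).mul_const _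
  have hl2 : Tendsto (fun k => (2 * ‖R (y k)‖ ^ 2 + ‖P (y k)‖ ^ 2) *
      (‖star R₀ (x k)‖ + η) ^ 2) atTop
      (𝓝 ((2 * 1 ^ 2 + ‖(0 : H)‖ ^ 2) * (‖(0 : H)‖ + η) ^ 2)) :=
    (((hRy.pow 2).const_mul 2).add (hPy.norm.pow 2)).mul ((hx1.norm.add_const η).pow 2)
  have := le_of_tendsto_of_tendsto' hl1 hl2 hstep
  simp only [norm_zero] at this
  nlinarith

/-! ### Varying the exponent -/

theorem continuousOn_rpow_exponent {A : H →L[ℂ] H} (hA : 0 ≤ A) :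
    ContinuousOn (fun q : ℝ => A ^ q) (Set.Ioi 0) := by
  intro q₀ hq₀
  have hK : IsCompact (spectrum ℝ A) := ContinuousFunctionalCalculus.isCompact_spectrum A
  have hcont : ContinuousOn (Function.uncurry fun q t : ℝ => t ^ q)
      (Set.Ioi 0 ×ˢ spectrum ℝ A) := by
    rintro ⟨q, t⟩ ⟨hq, -⟩
    exact ((Real.continuousAt_rpow_of_pos (t, q) hq).comp
      (f := Prod.swap) (x := (q, t)) continuous_swap.continuousAt).continuousWithinAt
  have h := continuousWithinAt_cfc_fun (f := fun q t : ℝ => t ^ q) (a := A) (x₀ := q₀)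
    (s := Set.Ioi 0) (fun u hu => by
      obtain ⟨v, hv, hvu⟩ := hK.mem_uniformity_of_prod hcont hq₀ (symm_le_uniformity hu)
      filter_upwards [hv] with q hq t ht
      exact hvu q hq t ht)
    (by filter_upwards [self_mem_nhdsWithin] with q hq
        exact (continuous_rpow_const_of_pos hq).continuousOn)
  simpa only [← CFC.rpow_eq_cfc_real hA] using h

theorem rpow_apply_eq_zero {A : H →L[ℂ] H} (hA : 0 ≤ A) {q : ℝ} (hq : 0 < q) {w : H}
    (hw : A w = 0) : (A ^ q) w = 0 := by
  by_cases h0 : w = 0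
  · simp [h0]
  have hn : ‖w‖ ≠ 0 := norm_ne_zero_iff.2 h0
  have h1 : ApproxEigen (fun _ : ℕ => ((‖w‖⁻¹ : ℝ) : ℂ) • w) (A ^ (1 : ℝ))
      (((0 : ℝ) ^ (1 : ℝ) : ℝ) : ℂ) := by
    simp [ApproxEigen, CFC.rpow_one A hA, hw]
  have h2 := h1.rpow (fun _ => by simp [norm_smul, hn]) hA le_rfl one_pos hq
  simp only [ApproxEigen, Real.zero_rpow hq.ne', Complex.ofReal_zero, zero_smul, sub_zero,
    tendsto_const_nhds_iff, map_smul] at h2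
  exact (smul_eq_zero.1 h2).resolve_left (by exact_mod_cast inv_ne_zero hn)

namespace IsPolarPHyponormal

variable {p : ℝ} {U A : H →L[ℂ] H}

/-- The operators `U A^q` lie in the bicommutant of `{U A, (U A)*}`. For `q < 1` the factor `U`
itself need not, because it is not determined on the kernel of `A`. -/
theorem commute_mul_rpow (h : IsPolarPHyponormal p U A) {X : H →L[ℂ] H}
    (h1 : Commute X (U * A)) (h2 : Commute X (star (U * A))) {q : ℝ} (hq : 0 < q) :
    Commute X (U * A ^ q) := by
  have hA := h.nonneg
  have hXA2 : Commute X (A ^ (2 * 1 : ℝ)) := by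
    rw [← h.star_mul_self one_pos, CFC.rpow_one A hA]
    exact h2.mul_right h1
  have hXA : ∀ s : ℝ, 0 < s → Commute X (A ^ s) := by
    intro s hs
    have : A ^ s = (A ^ (2 * 1 : ℝ)) ^ (s / 2) := by
      rw [CFC.rpow_rpow_of_exponent_nonneg A _ _ (by norm_num) (by positivity)]
      congr 1; ring
    rw [this, CFC.rpow_eq_cfc_real CFC.rpow_nonneg]
    exact (hXA2.symm.cfc_real _).symm
  have hXA1 : Commute X A := by simpa [CFC.rpow_one A hA] using hXA 1 one_pos
  have hY : (X * U - U * X) * A = 0 := by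
    rw [sub_mul, mul_assoc, h1.eq, mul_assoc, mul_assoc, hXA1.eq, sub_self]
  have hY' : (X * U - U * X) * A ^ q = 0 := by
    have h3 : A * star (X * U - U * X) = 0 := by
      have := congrArg star hY
      rwa [star_mul, star_zero, (IsSelfAdjoint.of_nonneg hA).star_eq] at this
    have h4 : A ^ q * star (X * U - U * X) = 0 := by
      ext v
      exact rpow_apply_eq_zero hA hq (congrArg (fun L : H →L[ℂ] H => L v) h3)
    have := congrArg star h4
    rwa [star_mul, star_zero, star_star, isSelfAdjoint_rpow.star_eq] at this
  rw [sub_mul, sub_eq_zero] at hY'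
  change X * (U * A ^ q) = U * A ^ q * X
  rw [← mul_assoc, hY', mul_assoc, (hXA q hq).eq, mul_assoc]

theorem continuousOn_mul_rpow_sub (h : IsPolarPHyponormal p U A) (r : ℝ) (e : ℂ) :
    ContinuousOn (fun q : ℝ => U * A ^ q - (((r ^ q : ℝ) : ℂ) * e) • (1 : H →L[ℂ] H))
      (Set.Ioi 0) := by
  have h1 : ContinuousOn (fun q : ℝ => r ^ q) (Set.Ioi 0) := fun q hq =>
    ((Real.continuousAt_rpow_of_pos (r, q) hq).comp
      (f := fun q : ℝ => (r, q)) (by fun_prop)).continuousWithinAt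
  have h2 := continuousOn_rpow_exponent h.nonneg
  exact (continuousOn_const.mul h2).sub
    (((Complex.continuous_ofReal.comp_continuousOn h1).mul continuousOn_const).smul
      continuousOn_const)

/-- If `P` is a self-adjoint operator commuting with the operators `U A^q`, then the position of
the points `r^q e` with respect to the spectrum of `U A^q`, localized to the approximate kernel
of `P`, does not depend on the exponent `q`.

On a connected set of exponents it suffices to see this locally. If the point is an approximate
eigenvalue it is one for all `q`; otherwise a perturbation of `q` does not affect invertibility. -/
theorem hasJointApproxKernel_iff (h : IsPolarPHyponormal p U A) (hp : 0 < p) {r : ℝ}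
    (hr : 0 ≤ r) {e : ℂ} (he : ‖e‖ = 1) {P : H →L[ℂ] H} (hP : IsSelfAdjoint P)
    (hPU : ∀ q : ℝ, 0 < q → Commute P (U * A ^ q)) {q q' : ℝ} (hq : p ≤ q) (hq' : p ≤ q') :
    HasJointApproxKernel
        ![star (U * A ^ q - (((r ^ q : ℝ) : ℂ) * e) • (1 : H →L[ℂ] H)), P] ↔
      HasJointApproxKernel
        ![star (U * A ^ q' - (((r ^ q' : ℝ) : ℂ) * e) • (1 : H →L[ℂ] H)), P] := by
  set R : ℝ → H →L[ℂ] H := fun q => U * A ^ q - (((r ^ q : ℝ) : ℂ) * e) • (1 : H →L[ℂ] H)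
    with hR
  have hRc : ContinuousOn R (Set.Ici p) :=
    (h.continuousOn_mul_rpow_sub r e).mono fun q hq => hp.trans_le hq
  have hcomm : ∀ q, p ≤ q → Commute P (R q) := fun q hq =>
    (hPU q (hp.trans_le hq)).sub_right ((Commute.one_right P).smul_right _)
  have hclose : ∀ q₀ ∈ Set.Ici p, ∀ δ > 0, ∀ᶠ q in 𝓝[Set.Ici p] q₀, ‖R q - R q₀‖ < δ := by
    intro q₀ hq₀ δ hδ
    have := Metric.tendsto_nhds.1 (hRc q₀ hq₀) δ hδ
    simpa only [dist_eq_norm] using this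
  refine isPreconnected_Ici.induction₂
    (fun q q' => HasJointApproxKernel ![star (R q), P] ↔ HasJointApproxKernel ![star (R q'), P])
    (fun q₀ hq₀ => ?_) (fun _ _ _ _ _ _ => Iff.trans) (fun _ _ _ _ => Iff.symm) hq hq'
  by_cases hG : HasJointApproxKernel ![star (R q₀), P]
  · by_cases hK : HasJointApproxKernel ![R q₀, P]
    · obtain ⟨x, hx, hL⟩ := hK
      have hx1 : ApproxEigen x (U * A ^ q₀) (((r ^ q₀ : ℝ) : ℂ) * e) :=
        approxEigen_iff.2 (hL 0)
      filter_upwards [self_mem_nhdsWithin] with q hq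
      refine iff_of_true hG ⟨x, hx, ?_⟩
      have h1 := h.approxEigen_star hp hq hx
        (h.approxEigen_rpow hp hq₀ (hp.trans_le hq) hr hx he hx1)
      rw [approxEigen_iff] at h1
      refine Fin.forall_fin_two.2 ⟨?_, hL 1⟩
      simpa [hR] using h1
    · obtain ⟨c, hc, hb⟩ := exists_lower_bound_of_not_hasJointApproxKernel hK
      simp only [Fin.sum_univ_two, Matrix.cons_val_zero, Matrix.cons_val_one] at hb
      filter_upwards [hclose q₀ hq₀ (Real.sqrt c / 2) (by positivity), self_mem_nhdsWithin]
        with q hq hqp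
      refine iff_of_true hG
        (hasJointApproxKernel_star_of_norm_sub_lt hP (hcomm q hqp) hb ?_ hG)
      have h1 : ‖R q - R q₀‖ ^ 2 < (Real.sqrt c / 2) ^ 2 := by gcongr
      rw [div_pow, Real.sq_sqrt hc.le] at h1
      linarith
  · obtain ⟨c, hc, hb⟩ := exists_lower_bound_of_not_hasJointApproxKernel hG
    simp only [Fin.sum_univ_two, Matrix.cons_val_zero, Matrix.cons_val_one] at hb
    filter_upwards [hclose q₀ hq₀ (Real.sqrt c) (by positivity)] with q hq
    refine iff_of_false hG (not_hasJointApproxKernel_of_norm_sub_lt hb ?_)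
    have h1 : ‖R q - R q₀‖ ^ 2 < Real.sqrt c ^ 2 := by gcongr
    rwa [← star_sub, norm_star, ← Real.sq_sqrt hc.le]

end IsPolarPHyponormal

end Exponent

/-! ### The Koszul complex of a doubly commuting tuple -/

section Koszul

variable {H : Type*} [NormedAddCommGroup H] [InnerProductSpace ℂ H]

/-- The sign `(-1)^{#{j ∈ s : j < i}}` of moving `e_i` to its place in the wedge product over `s`.
It does not matter whether `i` itself belongs to `s`. -/
def koszulSign {n : ℕ} (i : Fin n) (s : Finset (Fin n)) : ℂ :=
  (-1) ^ (s.filter (fun j => j < i)).card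

/-- The Koszul boundary map on the whole of `H ⊗ Λ(ℂⁿ)`, all degrees together; it acts on
families indexed by all subsets of `Fin n`. -/
def totalD {n : ℕ} (R : Fin n → H →L[ℂ] H) (f : Finset (Fin n) → H) (s : Finset (Fin n)) : H :=
  ∑ i, if i ∈ s then 0 else koszulSign i s • R i (f (insert i s))

/-- The coboundary map `x ⊗ ω ↦ ∑ Qᵢ x ⊗ eᵢ ∧ ω`. For `Q i = (R i)*` it is the adjoint of
`totalD R`. -/
def totalK {n : ℕ} (Q : Fin n → H →L[ℂ] H) (f : Finset (Fin n) → H) (s : Finset (Fin n)) : H :=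
  ∑ i, if i ∈ s then koszulSign i s • Q i (f (s.erase i)) else 0

section Signs

variable {n : ℕ} {i j : Fin n} {s : Finset (Fin n)}

theorem koszulSign_mul_self : koszulSign i s * koszulSign i s = 1 := by
  rw [koszulSign, ← mul_pow]; simp

theorem koszulSign_insert (hi : i ∉ s) :
    koszulSign j (insert i s) = (if i < j then -1 else 1) * koszulSign j s := by
  unfold koszulSign
  rw [Finset.filter_insert]
  split_ifs with h
  · rw [Finset.card_insert_of_notMem (by simp [hi]), pow_succ]; ring
  · rw [one_mul]

theorem koszulSign_insert_self : koszulSign i (insert i s) = koszulSign i s := by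
  unfold koszulSign
  rw [Finset.filter_insert, if_neg (lt_irrefl i)]

theorem koszulSign_erase (hi : i ∈ s) :
    koszulSign j (s.erase i) = (if i < j then -1 else 1) * koszulSign j s := by
  conv_rhs => rw [← Finset.insert_erase hi, koszulSign_insert (Finset.notMem_erase i s)]
  split_ifs <;> ring

end Signs

theorem sum_sum_eq_zero_of_antisymm {ι : Type*} [Fintype ι] {F : ι → ι → H}
    (h : ∀ i j, F i j = -F j i) : ∑ i, ∑ j, F i j = 0 := by
  have h1 : ∑ i, ∑ j, F i j = -∑ i, ∑ j, F i j := by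
    conv_lhs => rw [Finset.sum_comm]
    simp only [← Finset.sum_neg_distrib]
    exact Finset.sum_congr rfl fun i _ => Finset.sum_congr rfl fun j _ => h j i
  have h2 : (2 : ℂ) • ∑ i, ∑ j, F i j = 0 := by
    rw [two_smul]
    exact eq_neg_iff_add_eq_zero.1 h1
  exact (smul_eq_zero.1 h2).resolve_left two_ne_zero

theorem totalD_totalD {n : ℕ} {R : Fin n → H →L[ℂ] H} (hR : ∀ i j, Commute (R i) (R j))
    (f : Finset (Fin n) → H) : totalD R (totalD R f) = 0 := by
  ext s
  have : totalD R (totalD R f) s = ∑ i, ∑ j, if i ∈ s ∨ j ∈ s ∨ i = j then 0 else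
      ((if i < j then -1 else 1) * (koszulSign i s * koszulSign j s)) •
        R i (R j (f (insert j (insert i s)))) := by
    unfold totalD
    refine Finset.sum_congr rfl fun i _ => ?_
    by_cases hi : i ∈ s
    · simp [hi]
    · rw [if_neg hi, map_sum, Finset.smul_sum]
      refine Finset.sum_congr rfl fun j _ => ?_
      by_cases hj : j ∈ s
      · simp [hj]
      · by_cases hij : i = j
        · subst hij; simp
        · rw [if_neg (by simp [hj, Ne.symm hij]), if_neg (by simp [hi, hj, hij]), map_smul,
            smul_smul, koszulSign_insert hi]
          congr 1; ring
  rw [this, Pi.zero_apply]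
  refine sum_sum_eq_zero_of_antisymm fun i j => ?_
  by_cases h : i ∈ s ∨ j ∈ s ∨ i = j
  · rw [if_pos h, if_pos (by tauto), neg_zero]
  · have h' : ¬(j ∈ s ∨ i ∈ s ∨ j = i) := by tauto
    rw [if_neg h, if_neg h', Finset.insert_comm, ← mul_apply_eq_comp,
      ← mul_apply_eq_comp, (hR i j).eq, ← neg_smul]
    push Not at h
    congr 1
    rcases lt_or_gt_of_ne h.2.2 with h1 | h1
    · rw [if_pos h1, if_neg h1.not_gt]; ring
    · rw [if_neg h1.not_gt, if_pos h1]; ring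

/-- The diagonal entry at `s` of the Laplacian `D D* + D* D` of the Koszul complex, where `Q i`
stands for `(R i)*`. -/
noncomputable def laplacian {n : ℕ} (R Q : Fin n → H →L[ℂ] H) (s : Finset (Fin n)) :
    H →L[ℂ] H :=
  ∑ i, if i ∈ s then Q i * R i else R i * Q i

/-- For a doubly commuting tuple the Laplacian of the Koszul complex is diagonal. -/
theorem totalD_totalK_add {n : ℕ} {R Q : Fin n → H →L[ℂ] H}
    (hRQ : ∀ i j, i ≠ j → Commute (R i) (Q j)) (f : Finset (Fin n) → H) (s : Finset (Fin n)) :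
    totalD R (totalK Q f) s + totalK Q (totalD R f) s = laplacian R Q s (f s) := by
  have h1 : totalD R (totalK Q f) s = ∑ i, ∑ j,
      ((if i = j ∧ i ∉ s then R i (Q i (f s)) else 0) + (if i ∉ s ∧ j ∈ s then
        ((if i < j then -1 else 1) * (koszulSign i s * koszulSign j s)) •
          R i (Q j (f (insert i (s.erase j)))) else 0)) := by
    unfold totalD totalK
    refine Finset.sum_congr rfl fun i _ => ?_
    by_cases hi : i ∈ s
    · simp [hi]
    · rw [if_neg hi, map_sum, Finset.smul_sum]
      refine Finset.sum_congr rfl fun j _ => ?_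
      by_cases hij : i = j
      · subst hij
        simp [hi, koszulSign_insert_self, smul_smul, koszulSign_mul_self]
      · by_cases hj : j ∈ s
        · rw [if_pos (by simp [hj]), if_neg (by simp [hij]), if_pos ⟨hi, hj⟩, zero_add, map_smul,
            smul_smul, koszulSign_insert hi, Finset.erase_insert_of_ne hij]
          congr 1; ring
        · simp [hi, hj, hij, Ne.symm hij]
  have h2 : totalK Q (totalD R f) s = ∑ i, ∑ j,
      ((if i = j ∧ i ∈ s then Q i (R i (f s)) else 0) - (if i ∉ s ∧ j ∈ s then
        ((if i < j then -1 else 1) * (koszulSign i s * koszulSign j s)) •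
          R i (Q j (f (insert i (s.erase j)))) else 0)) := by
    unfold totalD totalK
    rw [Finset.sum_comm]
    refine Finset.sum_congr rfl fun j _ => ?_
    by_cases hj : j ∈ s
    · rw [if_pos hj, map_sum, Finset.smul_sum]
      refine Finset.sum_congr rfl fun i _ => ?_
      by_cases hij : i = j
      · subst hij
        simp [hj, koszulSign_erase, smul_smul, koszulSign_mul_self, Finset.insert_erase]
      · by_cases hi : i ∈ s
        · simp [hi, hj, hij]
        · rw [if_neg (by simp [hi]), if_neg (by simp [hij]), if_pos ⟨hi, hj⟩, zero_sub, map_smul,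
            smul_smul, koszulSign_erase hj, ← mul_apply_eq_comp, ← mul_apply_eq_comp,
            (hRQ i j hij).eq, ← neg_smul]
          congr 1
          rcases lt_or_gt_of_ne hij with h | h
          · rw [if_pos h, if_neg h.not_gt]; ring
          · rw [if_neg h.not_gt, if_pos h]; ring
    · rw [if_neg hj]
      symm
      refine Finset.sum_eq_zero fun i _ => ?_
      by_cases hij : i = j
      · subst hij; simp [hj]
      · simp [hj, hij]
  rw [h1, h2, ← Finset.sum_add_distrib, laplacian, sum_apply]
  refine Finset.sum_congr rfl fun i _ => ?_
  rw [← Finset.sum_add_distrib, Finset.sum_eq_single i]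
  · by_cases hi : i ∈ s <;> simp [hi]
  · intro j _ hij
    simp [Ne.symm hij]
  · simp

/-- The Laplacian commutes with the boundary map. -/
theorem laplacian_mul {n : ℕ} {R Q : Fin n → H →L[ℂ] H} (hR : ∀ i j, Commute (R i) (R j))
    (hRQ : ∀ i j, i ≠ j → Commute (R i) (Q j)) {i : Fin n} {s : Finset (Fin n)} (hi : i ∉ s) :
    laplacian R Q s * R i = R i * laplacian R Q (insert i s) := by
  unfold laplacian
  rw [Finset.sum_mul, Finset.mul_sum]
  refine Finset.sum_congr rfl fun j _ => ?_
  by_cases hij : i = j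
  · subst hij
    simp [hi, mul_assoc]
  · have hR' := hR i j
    have hQ' := hRQ i j hij
    by_cases hj : j ∈ s
    · rw [if_pos hj, if_pos (by simp [hj])]
      exact (hQ'.mul_right hR').eq.symm
    · rw [if_neg hj, if_neg (by simp [hj, Ne.symm hij])]
      exact (hR'.mul_right hQ').eq.symm

/-- If all diagonal entries of the Laplacian are invertible, the total Koszul complex is exact. -/
theorem exists_totalD_eq {n : ℕ} {R Q : Fin n → H →L[ℂ] H} (hR : ∀ i j, Commute (R i) (R j))
    (hRQ : ∀ i j, i ≠ j → Commute (R i) (Q j)) (hL : ∀ s, IsUnit (laplacian R Q s))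
    {f : Finset (Fin n) → H} (hf : totalD R f = 0) : ∃ g, totalD R g = f := by
  choose u hu using hL
  refine ⟨fun s => ((u s)⁻¹ : (H →L[ℂ] H)ˣ).1 (totalK Q f s), ?_⟩
  ext s
  have hcomm : ∀ i, i ∉ s → ∀ v, R i (((u (insert i s))⁻¹ : (H →L[ℂ] H)ˣ).1 v) =
      ((u s)⁻¹ : (H →L[ℂ] H)ˣ).1 (R i v) := by
    intro i hi v
    have h1 : (u s).1 * R i = R i * (u (insert i s)).1 := by
      rw [hu, hu]; exact laplacian_mul hR hRQ hi
    have h2 : R i * ((u (insert i s))⁻¹ : (H →L[ℂ] H)ˣ).1 =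
        ((u s)⁻¹ : (H →L[ℂ] H)ˣ).1 * R i := by
      rw [Units.mul_inv_eq_iff_eq_mul, mul_assoc, ← h1, Units.inv_mul_cancel_left]
    exact congrArg (fun L : H →L[ℂ] H => L v) h2
  have h0 : totalK Q (totalD R f) s = 0 := by
    rw [hf]; simp [totalK]
  have h3 := totalD_totalK_add hRQ f s
  rw [h0, add_zero, ← hu] at h3
  have h4 : totalD R (fun s => ((u s)⁻¹ : (H →L[ℂ] H)ˣ).1 (totalK Q f s)) s =
      ((u s)⁻¹ : (H →L[ℂ] H)ˣ).1 (totalD R (totalK Q f) s) := by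
    unfold totalD
    rw [map_sum]
    refine Finset.sum_congr rfl fun i _ => ?_
    by_cases hi : i ∈ s
    · simp [hi]
    · rw [if_neg hi, if_neg hi, hcomm i hi, map_smul]
  rw [h4, h3, ← mul_apply_eq_comp, Units.inv_mul, one_apply_eq_self]

section Degrees

variable {n : ℕ}

/-- The component of degree `k` of an element of `H ⊗ Λ(ℂⁿ)`. -/
def component {X : Type*} (k : ℕ) (f : Finset (Fin n) → X) : E n k X := fun s => f s.1

/-- The inclusion of `H ⊗ Λᵏ(ℂⁿ)` into `H ⊗ Λ(ℂⁿ)`. -/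
def extend {X : Type*} [Zero X] {k : ℕ} (f : E n k X) (s : Finset (Fin n)) : X :=
  if h : s.card = k then f ⟨s, h⟩ else 0

theorem component_extend {X : Type*} [Zero X] {k : ℕ} (f : E n k X) : component k (extend f) = f := by
  ext s
  simp [component, extend, s.2]

theorem koszulD_component (R : Fin n → H →L[ℂ] H) (k : ℕ) (f : Finset (Fin n) → H) :
    koszulD R k (component (k + 1) f) = component k (totalD R f) := by
  ext s
  simp only [koszulD, LinearMap.pi_apply, LinearMap.sum_apply, LinearMap.smul_apply,
    LinearMap.comp_apply, LinearMap.proj_apply, component, insertIdx, totalD,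
    ContinuousLinearMap.coe_coe]
  rw [Finset.sum_ite, Finset.sum_const_zero, zero_add]
  exact (Finset.sum_subtype (Finset.univ.filter fun i => i ∉ s.1) (by simp)
    (fun i => koszulSign i s.1 • R i (f (insert i s.1)))).symm

theorem totalD_extend_apply_of_card_ne (R : Fin n → H →L[ℂ] H) {k : ℕ} (f : E n k H)
    {s : Finset (Fin n)} (hs : s.card + 1 ≠ k) : totalD R (extend f) s = 0 := by
  refine Finset.sum_eq_zero fun i _ => ?_
  by_cases hi : i ∈ s
  · simp [hi]
  · rw [if_neg hi, extend, dif_neg (by rwa [Finset.card_insert_of_notMem hi]), map_zero, smul_zero]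

/-- Exactness of the total complex passes to its homogeneous components. -/
theorem koszulExact_of_totalD {R : Fin n → H →L[ℂ] H} (hR : ∀ i j, Commute (R i) (R j))
    (h : ∀ f, totalD R f = 0 → ∃ g, totalD R g = f) : KoszulExact R := by
  have hlift : ∀ k (y : E n k H), totalD R (extend y) = 0 → ∃ x, koszulD R k x = y := by
    intro k y hy
    obtain ⟨g, hg⟩ := h _ hy
    exact ⟨component (k + 1) g, by rw [koszulD_component, hg, component_extend]⟩
  refine ⟨fun y => hlift 0 y ?_, fun k y => ⟨fun hy => hlift (k + 1) y ?_, ?_⟩⟩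
  · ext s
    exact totalD_extend_apply_of_card_ne R y (Nat.succ_ne_zero _)
  · ext s
    by_cases hs : s.card = k
    · rw [← component_extend y, koszulD_component] at hy
      exact congrFun hy ⟨s, hs⟩
    · exact totalD_extend_apply_of_card_ne R y (by omega)
  · rintro ⟨x, rfl⟩
    rw [← component_extend x, koszulD_component, koszulD_component, totalD_totalD hR]
    rfl

end Degrees

variable [CompleteSpace H]

/-- Only surjectivity of the last map `(xᵢ) ↦ ∑ Rᵢ xᵢ` matters here: by the open mapping theorem
unit vectors have bounded preimages, which cannot be if all `Rᵢ* xₖ` tend to zero. -/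
theorem not_hasJointApproxKernel_star_of_koszulExact {n : ℕ} {R : Fin n → H →L[ℂ] H}
    (h : KoszulExact R) : ¬ HasJointApproxKernel fun j => star (R j) := by
  rintro ⟨x, hx, hL⟩
  set Φ : (Fin n → H) →L[ℂ] H := ∑ i, (R i).comp (ContinuousLinearMap.proj i) with hΦ
  have hΦa : ∀ g, Φ g = ∑ i, R i (g i) := fun g => by simp [hΦ]
  have hsurj : Function.Surjective Φ := by
    intro v
    obtain ⟨f, hf⟩ := h.1 fun _ => v
    have h1 := congrFun hf ⟨∅, rfl⟩
    rw [← component_extend f, koszulD_component] at h1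
    refine ⟨fun i => koszulSign i ∅ • extend f (insert i ∅), ?_⟩
    rw [hΦa, ← h1]
    simp [component, totalD]
  obtain ⟨C, hC, hpre⟩ := Φ.exists_preimage_norm_le hsurj
  choose g hg hgC using hpre
  have hlim : Tendsto (fun k => ∑ i, (⟪g (x k) i, star (R i) (x k)⟫_ℂ).re) atTop (𝓝 0) := by
    have := tendsto_finsetSum Finset.univ fun i _ =>
      tendsto_inner_zero_right (x := fun k => g (x k) i) (C := C)
        (fun k => (norm_le_pi_norm _ i).trans (by simpa [hx k] using hgC (x k))) (hL i)
    simpa using this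
  have hone : ∀ k, ∑ i, (⟪g (x k) i, star (R i) (x k)⟫_ℂ).re = 1 := by
    intro k
    have h1 : (⟪x k, x k⟫_ℂ).re = 1 := by rw [re_inner_self, hx k, one_pow]
    rw [← h1]
    have h2 : ⟪x k, x k⟫_ℂ = ⟪Φ (g (x k)), x k⟫_ℂ := by rw [hg]
    rw [h2, hΦa, sum_inner, Complex.re_sum]
    refine Finset.sum_congr rfl fun i _ => ?_
    rw [ContinuousLinearMap.star_eq_adjoint, ContinuousLinearMap.adjoint_inner_right]
  simp only [hone] at hlim
  exact one_ne_zero (tendsto_nhds_unique tendsto_const_nhds hlim)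

/-- Exactness of the Koszul complex for a doubly commuting tuple whose members have the property
that a sequence of approximate null vectors of `R j` is one of `(R j)*`. -/
theorem koszulExact_iff {n : ℕ} {R : Fin n → H →L[ℂ] H} (hR : DoublyCommuting R)
    (hstar : ∀ j, ∀ x : ℕ → H, (∀ k, ‖x k‖ = 1) → Tendsto (fun k => R j (x k)) atTop (𝓝 0) →
      Tendsto (fun k => star (R j) (x k)) atTop (𝓝 0)) :
    KoszulExact R ↔ ¬ HasJointApproxKernel fun j => star (R j) := by
  refine ⟨not_hasJointApproxKernel_star_of_koszulExact, fun h => ?_⟩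
  have hcomm : ∀ i j, Commute (R i) (R j) := fun i j => by
    by_cases hij : i = j
    · rw [hij]
    · exact (hR i j hij).1
  refine koszulExact_of_totalD hcomm fun f => exists_totalD_eq (Q := fun j => star (R j)) hcomm
    (fun i j hij => (hR i j hij).2) fun s => ?_
  have h1 : ¬ HasJointApproxKernel fun j => if j ∈ s then R j else star (R j) := by
    rintro ⟨x, hx, hL⟩
    refine h ⟨x, hx, fun j => ?_⟩
    have h2 := hL j
    by_cases hj : j ∈ s
    · simp only [hj, if_true] at h2
      exact hstar j x hx h2
    · simpa only [hj, if_false] using h2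
  convert isUnit_sum_star_mul_self h1 using 1
  refine Finset.sum_congr rfl fun j _ => ?_
  by_cases hj : j ∈ s <;> simp [hj]

end Koszul

/-! ### Doubly commuting tuples of `p`-hyponormal operators -/

section DoublyCommutingTuples

variable {H : Type*} [NormedAddCommGroup H] [InnerProductSpace ℂ H] [CompleteSpace H]

theorem conj_unitary_rpow {U B : H →L[ℂ] H} (hU : U ∈ unitary (H →L[ℂ] H)) (hB : 0 ≤ B) {s : ℝ}
    (hs : 0 < s) : (U * B * star U) ^ s = U * B ^ s * star U := by
  have hc : Continuous (Unitary.conjStarAlgAut ℂ (H →L[ℂ] H) ⟨U, hU⟩) := by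
    change Continuous fun X => U * X * star U
    fun_prop
  have h1 : 0 ≤ U * B * star U := star_right_conjugate_nonneg hB U
  rw [CFC.rpow_eq_cfc_real h1, CFC.rpow_eq_cfc_real hB]
  exact (StarAlgHomClass.map_cfc (S := ℂ) (Unitary.conjStarAlgAut ℂ (H →L[ℂ] H) ⟨U, hU⟩)
    (fun t : ℝ => t ^ s) B (continuous_rpow_const_of_pos hs).continuousOn hc
    (IsSelfAdjoint.of_nonneg hB) (IsSelfAdjoint.of_nonneg h1)).symm

theorem IsPHyponormal.isPolarPHyponormal {p : ℝ} (hp : 0 < p) {T U : H →L[ℂ] H}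
    (hT : IsPHyponormal p T) (hU : U ∈ unitary (H →L[ℂ] H)) (hpolar : T = U * CFC.abs T) :
    IsPolarPHyponormal p U (CFC.abs T) := by
  have hA : 0 ≤ CFC.abs T := CFC.abs_nonneg T
  have hsq : CFC.abs T * CFC.abs T = CFC.abs T ^ (2 : ℝ) := by
    have := rpow_mul_rpow hA one_pos one_pos
    rwa [CFC.rpow_one _ hA, one_add_one_eq_two] at this
  have h1 : star T * T = CFC.abs T ^ (2 : ℝ) := by rw [← CFC.abs_mul_abs, hsq]
  have h2 : T * star T = U * CFC.abs T ^ (2 : ℝ) * star U := by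
    rw [← hsq]
    conv_lhs => rw [hpolar]
    rw [star_mul, (IsSelfAdjoint.of_nonneg hA).star_eq]
    simp only [mul_assoc]
  refine ⟨hU, hA, ?_⟩
  have h3 := hT
  rwa [IsPHyponormal, h1, h2, conj_unitary_rpow hU CFC.rpow_nonneg hp,
    CFC.rpow_rpow_of_exponent_nonneg _ _ _ (by norm_num) hp.le] at h3

section Tuples

variable {n : ℕ} {p : ℝ} {U A : Fin n → H →L[ℂ] H}

/-- Arbitrary positive powers of the moduli again give a doubly commuting tuple. -/
theorem commute_mul_rpow_mul_rpow (h : ∀ j, IsPolarPHyponormal p (U j) (A j))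
    (hc : DoublyCommuting fun j => U j * A j) {i j : Fin n} (hij : i ≠ j) {a b : ℝ} (ha : 0 < a)
    (hb : 0 < b) : Commute (U i * A i ^ a) (U j * A j ^ b) ∧
      Commute (U i * A i ^ a) (star (U j * A j ^ b)) := by
  have key : ∀ X : H →L[ℂ] H, Commute X (U i * A i) → Commute X (star (U i * A i)) →
      Commute X (U i * A i ^ a) ∧ Commute X (star (U i * A i ^ a)) := by
    intro X h1 h2
    refine ⟨(h i).commute_mul_rpow h1 h2 ha, ?_⟩
    have h3 := (h i).commute_mul_rpow (X := star X) (by simpa using h2.star_star) h1.star_star ha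
    simpa using h3.star_star
  obtain ⟨h1, h2⟩ := key (U j * A j) (hc j i hij.symm).1 (hc j i hij.symm).2
  have h3 := (h j).commute_mul_rpow h1.symm (by simpa using h2.symm.star_star) hb
  have h4 := (h j).commute_mul_rpow h2.symm h1.symm.star_star hb
  exact ⟨h3, by simpa using h4.star_star⟩

/-- A family has a joint approximate kernel if and only if the pair consisting of one of its
members `L i` and of the sum `∑ (L j)* L j` over the others has one. -/
theorem hasJointApproxKernel_iff_pair (L : Fin n → H →L[ℂ] H) (i : Fin n) :
    HasJointApproxKernel L ↔
      HasJointApproxKernel ![L i, ∑ j ∈ Finset.univ.erase i, star (L j) * L j] := by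
  constructor
  · rintro ⟨x, hx, h⟩
    refine ⟨x, hx, Fin.forall_fin_two.2 ⟨h i, ?_⟩⟩
    have := tendsto_finsetSum (Finset.univ.erase i) fun j _ => tendsto_clm_zero (star (L j)) (h j)
    simpa using this
  · rintro ⟨x, hx, h⟩
    refine ⟨x, hx, fun j => ?_⟩
    by_cases hji : j = i
    · subst hji; exact h 0
    have h1 := tendsto_inner_zero_left (fun k => (hx k).le) (h 1)
    have h2 : Tendsto (fun k => ‖L j (x k)‖ ^ 2) atTop (𝓝 0) := by
      refine squeeze_zero (fun k => sq_nonneg _) (fun k => ?_) h1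
      simp only [Matrix.cons_val_one, Matrix.cons_val_fin_one]
      rw [sum_apply, sum_inner, Complex.re_sum]
      simp only [re_inner_star_mul_self]
      exact Finset.single_le_sum (f := fun j => ‖L j (x k)‖ ^ 2) (fun j _ => sq_nonneg _)
        (Finset.mem_erase.2 ⟨hji, Finset.mem_univ j⟩)
    exact tendsto_zero_of_norm_sq h2

/-- The operators `U j |T j|^{q j} - (r j)^{q j} e j` of a tuple with exponents `q`. -/
noncomputable def shiftedTuple (U A : Fin n → H →L[ℂ] H) (r : Fin n → ℝ) (e : Fin n → ℂ)
    (q : Fin n → ℝ) (j : Fin n) : H →L[ℂ] H :=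
  U j * A j ^ q j - (((r j ^ q j : ℝ) : ℂ) * e j) • (1 : H →L[ℂ] H)

/-- The exponents may be changed one at a time: the operators of the other coordinates enter only
through the sum `P = ∑ (L j)* L j`, with which the changing coordinate commutes. -/
theorem hasJointApproxKernel_shiftedTuple_update (hp : 0 < p)
    (h : ∀ j, IsPolarPHyponormal p (U j) (A j)) (hc : DoublyCommuting fun j => U j * A j)
    {r : Fin n → ℝ} (hr : ∀ j, 0 ≤ r j) {e : Fin n → ℂ} (he : ∀ j, ‖e j‖ = 1) {q : Fin n → ℝ}
    (hq : ∀ j, p ≤ q j) (i : Fin n) {b : ℝ} (hb : p ≤ b) :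
    HasJointApproxKernel (fun j => star (shiftedTuple U A r e q j)) ↔
      HasJointApproxKernel
        (fun j => star (shiftedTuple U A r e (Function.update q i b) j)) := by
  rw [hasJointApproxKernel_iff_pair _ i, hasJointApproxKernel_iff_pair (fun j => star
    (shiftedTuple U A r e (Function.update q i b) j)) i]
  have hP : ∑ j ∈ Finset.univ.erase i, star (star (shiftedTuple U A r e
        (Function.update q i b) j)) * star (shiftedTuple U A r e (Function.update q i b) j) =
      ∑ j ∈ Finset.univ.erase i, star (star (shiftedTuple U A r e q j)) *
        star (shiftedTuple U A r e q j) := by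
    refine Finset.sum_congr rfl fun j hj => ?_
    simp only [shiftedTuple, Function.update_of_ne (Finset.ne_of_mem_erase hj)]
  rw [hP]
  set P := ∑ j ∈ Finset.univ.erase i, star (star (shiftedTuple U A r e q j)) *
    star (shiftedTuple U A r e q j) with hPdef
  have hPsa : IsSelfAdjoint P := by
    refine isSelfAdjoint_sum _ fun j _ => ?_
    exact IsSelfAdjoint.star_mul_self _
  have hPU : ∀ s : ℝ, 0 < s → Commute P (U i * A i ^ s) := by
    intro s hs
    refine Commute.sum_left _ _ _ fun j hj => ?_
    have hji := Finset.ne_of_mem_erase hj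
    obtain ⟨h1, h2⟩ := commute_mul_rpow_mul_rpow h hc hji.symm hs (hp.trans_le (hq j))
    rw [star_star]
    refine Commute.mul_left ?_ ?_
    · exact h1.symm.sub_left ((Commute.one_left _).smul_left _)
    · rw [shiftedTuple, star_sub, star_smul, star_one]
      exact h2.symm.sub_left ((Commute.one_left _).smul_left _)
  have := (h i).hasJointApproxKernel_iff hp (hr i) (he i) hPsa hPU (hq i) hb
  simpa only [shiftedTuple, Function.update_self] using this

theorem hasJointApproxKernel_shiftedTuple_iff (hp : 0 < p)
    (h : ∀ j, IsPolarPHyponormal p (U j) (A j)) (hc : DoublyCommuting fun j => U j * A j)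
    {r : Fin n → ℝ} (hr : ∀ j, 0 ≤ r j) {e : Fin n → ℂ} (he : ∀ j, ‖e j‖ = 1) {a b : ℝ}
    (ha : p ≤ a) (hb : p ≤ b) :
    HasJointApproxKernel (fun j => star (shiftedTuple U A r e (fun _ => a) j)) ↔
      HasJointApproxKernel (fun j => star (shiftedTuple U A r e (fun _ => b) j)) := by
  have key : ∀ s : Finset (Fin n),
      HasJointApproxKernel (fun j => star (shiftedTuple U A r e (fun _ => a) j)) ↔
      HasJointApproxKernel
        (fun j => star (shiftedTuple U A r e (fun j => if j ∈ s then b else a) j)) := by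
    intro s
    induction s using Finset.induction_on with
    | empty => simp
    | insert i s hi ih =>
      refine ih.trans ?_
      rw [hasJointApproxKernel_shiftedTuple_update hp h hc hr he
        (fun j => by split_ifs <;> assumption) i hb]
      have : Function.update (fun j => if j ∈ s then b else a) i b =
          fun j => if j ∈ insert i s then b else a := by
        ext j
        by_cases hj : j = i
        · subst hj; simp
        · simp [hj]
      rw [this]
  simpa using key Finset.univ

theorem koszulExact_shiftedTuple_iff (hp : 0 < p)
    (h : ∀ j, IsPolarPHyponormal p (U j) (A j)) (hc : DoublyCommuting fun j => U j * A j)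
    {r : Fin n → ℝ} {e : Fin n → ℂ} {q : Fin n → ℝ} (hq : ∀ j, p ≤ q j) :
    KoszulExact (shiftedTuple U A r e q) ↔
      ¬ HasJointApproxKernel fun j => star (shiftedTuple U A r e q j) := by
  refine koszulExact_iff (fun i j hij => ?_) fun j x hx hL => ?_
  · obtain ⟨h1, h2⟩ := commute_mul_rpow_mul_rpow h hc hij (hp.trans_le (hq i))
      (hp.trans_le (hq j))
    refine ⟨?_, ?_⟩
    · exact (h1.sub_left ((Commute.one_left _).smul_left _)).sub_right
        ((Commute.one_right _).smul_right _)
    · rw [shiftedTuple, shiftedTuple, star_sub, star_smul, star_one]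
      exact (h2.sub_left ((Commute.one_left _).smul_left _)).sub_right
        ((Commute.one_right _).smul_right _)
  · have h1 := (h j).approxEigen_star hp (hq j) hx (approxEigen_iff.2 hL)
    rw [approxEigen_iff] at h1
    simpa [shiftedTuple] using h1

end Tuples

end DoublyCommutingTuples

end TaylorSpectrum

theorem corollary2p3 {H : Type*} [NormedAddCommGroup H] [InnerProductSpace ℂ H] [CompleteSpace H]
    (n : ℕ) (p : ℝ) (hp0 : 0 < p) (hp1 : p < 1)
    (T U : Fin n → H →L[ℂ] H)
    (hcomm : TaylorSpectrum.DoublyCommuting T)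
    (hT : ∀ j, TaylorSpectrum.IsPHyponormal p (T j))
    (hU : ∀ j, U j ∈ unitary (H →L[ℂ] H))
    (hpolar : ∀ j, T j = U j * CFC.abs (T j))
    (S : Fin n → H →L[ℂ] H)
    (hS : ∀ j, S j = U j * CFC.abs (T j) ^ (2 * p)) :
    (∀ i j, Commute (S i) (S j)) ∧
      TaylorSpectrum.taylorSpectrum S =
        {w : Fin n → ℂ | ∃ r θ : Fin n → ℝ, (∀ j, 0 ≤ r j) ∧
          (fun j => (r j : ℂ) * Complex.exp ((θ j : ℂ) * Complex.I)) ∈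
            TaylorSpectrum.taylorSpectrum T ∧
          w = fun j => ((r j ^ (2 * p) : ℝ) : ℂ) * Complex.exp ((θ j : ℂ) * Complex.I)} := by
  have h : ∀ j, TaylorSpectrum.IsPolarPHyponormal p (U j) (CFC.abs (T j)) := fun j =>
    (hT j).isPolarPHyponormal hp0 (hU j) (hpolar j)
  have hc : TaylorSpectrum.DoublyCommuting fun j => U j * CFC.abs (T j) := by
    simpa only [← hpolar] using hcomm
  have h2p : 0 < 2 * p := by linarith
  refine ⟨fun i j => ?_, ?_⟩
  · by_cases hij : i = j
    · rw [hij]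
    · rw [hS i, hS j]
      exact (TaylorSpectrum.commute_mul_rpow_mul_rpow h hc hij h2p h2p).1
  -- the points `r e^{iθ}` of one spectrum correspond to the points `r²ᵖ e^{iθ}` of the other
  have key : ∀ r θ : Fin n → ℝ, (∀ j, 0 ≤ r j) →
      ((fun j => (r j : ℂ) * Complex.exp ((θ j : ℂ) * Complex.I)) ∈
          TaylorSpectrum.taylorSpectrum T ↔
        (fun j => ((r j ^ (2 * p) : ℝ) : ℂ) * Complex.exp ((θ j : ℂ) * Complex.I)) ∈
          TaylorSpectrum.taylorSpectrum S) := by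
    intro r θ hr
    set e : Fin n → ℂ := fun j => Complex.exp ((θ j : ℂ) * Complex.I) with he
    have h1 : (fun j => T j - ((r j : ℂ) * e j) • (1 : H →L[ℂ] H)) =
        TaylorSpectrum.shiftedTuple U (fun j => CFC.abs (T j)) r e fun _ => 1 := by
      ext1 j
      rw [TaylorSpectrum.shiftedTuple, CFC.rpow_one _ (CFC.abs_nonneg _), ← hpolar, Real.rpow_one]
    have h2 : (fun j => S j - (((r j ^ (2 * p) : ℝ) : ℂ) * e j) • (1 : H →L[ℂ] H)) =
        TaylorSpectrum.shiftedTuple U (fun j => CFC.abs (T j)) r e fun _ => 2 * p := by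
      ext1 j
      rw [TaylorSpectrum.shiftedTuple, ← hS]
    simp only [TaylorSpectrum.taylorSpectrum, Set.mem_ofPred_eq]
    rw [h1, h2,
      TaylorSpectrum.koszulExact_shiftedTuple_iff hp0 h hc fun _ => hp1.le,
      TaylorSpectrum.koszulExact_shiftedTuple_iff hp0 h hc fun _ => by linarith,
      TaylorSpectrum.hasJointApproxKernel_shiftedTuple_iff hp0 h hc hr
        (fun j => Complex.norm_exp_ofReal_mul_I (θ j)) hp1.le (by linarith : p ≤ 2 * p)]
  ext w
  constructor
  · intro hw
    have hr : ∀ j, 0 ≤ ‖w j‖ ^ (2 * p)⁻¹ := fun j => by positivity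
    have hwj : w = fun j => (((‖w j‖ ^ (2 * p)⁻¹) ^ (2 * p) : ℝ) : ℂ) *
        Complex.exp (((w j).arg : ℂ) * Complex.I) := by
      ext1 j
      rw [Real.rpow_inv_rpow (norm_nonneg _) h2p.ne', Complex.norm_mul_exp_arg_mul_I]
    refine ⟨fun j => ‖w j‖ ^ (2 * p)⁻¹, fun j => (w j).arg, hr, ?_, hwj⟩
    rw [key _ _ hr, ← hwj]
    exact hw
  · rintro ⟨r, θ, hr, hz, rfl⟩
    exact (key r θ hr).1 hz
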